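/- Let $n \ge 3$ and let $S$ be a finite generating set of the group $\mathrm{SL}_n(\mathbb{Z})$. For every integer $i \ge 1$ let $\phi_i : \mathrm{SL}_n(\mathbb{Z}) \to \mathrm{SL}_n(\mathbb{Z}/i\mathbb{Z})$ be reduction modulo $i$, and let $G_i = (V_i, E_i)$ be the Cayley graph of $\mathrm{SL}_n(\mathbb{Z}/i\mathbb{Z})$ with respect to $\phi_i(S)$: its vertex set is $V_i = \mathrm{SL}_n(\mathbb{Z}/i\mathbb{Z})$, and two distinct vertices $x, y$ are adjacent if and only if $y = xs$ or $x = ys$ for some $s \in \phi_i(S)$. Then $\{G_i\}_{i \ge 1}$ is a super-expander family. That is, the finite graphs $G_i$ have uniformly bounded degree, $\lim_{i \to \infty} |V_i| = \infty$, and for every super-reflexive Banach space $\mathbb{E}$ (a Banach space that admits an equivalent uniformly convex norm) there are constants $p, \gamma \in (0, \infty)$ such that for every $i \ge 1$ and every map $\varphi : V_i \to \mathbb{E}$, $$\frac{1}{|V_i|^2} \sum_{(u,v) \in V_i \times V_i} \|\varphi(u) - \varphi(v)\|^p \le \frac{\gamma}{|V_i|} \sum_{(x,y) \in E_i} \|\varphi(x)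 - \varphi(y)\|^p,$$ where $E_i$ is the set of ordered pairs of adjacent vertices of $G_i$. -/

import Mathlib

open Filter

universe u v

/-- A real Banach space `E` is super-reflexive if it admits an equivalent uniformly convex norm,
i.e. if `E` is linearly homeomorphic to a uniformly convex normed space. -/
def IsSuperReflexive (E : Type u) [NormedAddCommGroup E] [NormedSpace ℝ E] : Prop :=
  ∃ (F : Type u) (_ : NormedAddCommGroup F) (_ : NormedSpace ℝ F),
    UniformConvexSpace F ∧ Nonempty (E ≃L[ℝ] F)

open Classical in
/-- A sequence `G i` of finite graphs has a Poincaré inequality with respect to `E`: there are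
`p, γ > 0` such that for all `i` and all maps `φ` from the vertices to `E`,
`|V i|⁻² ∑_{(u, v)} ‖φ u - φ v‖ ^ p ≤ γ |V i|⁻¹ ∑_{(x, y) edge} ‖φ x - φ y‖ ^ p`.
The last sum runs over ordered pairs of adjacent vertices. -/
def HasPoincareInequality (E : Type u) [NormedAddCommGroup E]
    (V : ℕ → Type v) [∀ i, Fintype (V i)] (G : ∀ i, SimpleGraph (V i)) : Prop :=
  ∃ p γ : ℝ, 0 < p ∧ 0 < γ ∧ ∀ (i : ℕ) (φ : V i → E),
    1 / (Fintype.card (V i) : ℝ) ^ 2 * ∑ e : V i × V i, ‖φ e.1 - φ e.2‖ ^ p ≤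
      γ / (Fintype.card (V i) : ℝ) *
        ∑ e : V i × V i with (G i).Adj e.1 e.2, ‖φ e.1 - φ e.2‖ ^ p

/-- A super-expander family: a sequence of finite graphs of uniformly bounded degree, with
numbers of vertices tending to infinity, that has a Poincaré inequality with respect to every
super-reflexive Banach space (in the universe `u`). -/
structure IsSuperExpanderFamily
    (V : ℕ → Type v) [∀ i, Fintype (V i)] (G : ∀ i, SimpleGraph (V i)) : Prop where
  bounded_degree : ∃ d : ℕ, ∀ (i : ℕ) (x : V i), ((G i).neighborSet x).ncard ≤ d
  tendsto_card : Tendsto (fun i => Fintype.card (V i)) atTop atTop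
  poincare : ∀ (E : Type u) [NormedAddCommGroup E] [NormedSpace ℝ E] [CompleteSpace E],
    IsSuperReflexive E → HasPoincareInequality E V G

/-- The image of a subset of `SL_n(ℤ)` under the reduction map `SL_n(ℤ) → SL_n(ℤ/mℤ)`. -/
def reducedGenerators (n m : ℕ) (S : Set (Matrix.SpecialLinearGroup (Fin n) ℤ)) :
    Set (Matrix.SpecialLinearGroup (Fin n) (ZMod m)) :=
  Matrix.SpecialLinearGroup.map (Int.castRingHom (ZMod m)) '' S

/-! It is enough to show, for the right regular representation on ℓ²(SL_n(ℤ/m); F) with F uniformly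
convex, that every group element moves a vector by at most a constant times what the generators do,
uniformly in m (`exists_forall_norm_map_sub_le`). Summing squares gives the inequality with p = 2,
and an isomorphism E ≃ F transfers it. The spaces ℓ²(V; F) are uniformly convex at one fixed scale,
independently of V (`exists_isRound_piLp`).

The analytic core concerns contractions x, y with central commutator z. Let X_a be the mean of the
powers x^i, i < 2^a, and likewise Y_b, Z_e. Then X_a Y_b Z_e (1 - z^(2^e)) is exponentially small in
n when e + 3n ≤ a + b and all scales are at least 5n (`heisenberg_decay`). Indeed, if a further
averaging over x hardly shrinks a vector of this kind, uniform convexity makes the vector almost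
fixed by a power of x. It is also almost fixed by a power of y, hence by a commutator ζ, a power of
z; having a factor 1 - ζ, it is then small.

So in X_a Z_c Y_b the scale c may be changed cheaply while it stays below a + b, and X_a, Y_b may be
exchanged cheaply once c is well above a + b. The six root elements of SL₃ form a hexagon in which
any three consecutive ones are of this kind. Alternating the two moves sends the scales of a
six-letter word to infinity along a Cauchy sequence (`norm_hexagonWord_step_le`), whose limit is
fixed by x₀. One fixed word moves ξ by a constant times the displacements of the root elements, so
all powers of x₀ move ξ by at most C D + ε‖ξ‖, with C independent of the power and of the
representation.

Every element of SL_n(ℤ/m) is a product of boundedly many transvections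
(`isTransvectionProduct_of_finite`), each a power of a root element. For small ε the term in ‖ξ‖ is
absorbed by subtracting the orbit mean (`norm_map_sub_le_of_half`). -/

/-! ### Dyadic means of a contraction -/

section DyadicMean

variable {E : Type*} [NormedAddCommGroup E] [NormedSpace ℝ E]

/-- The mean of the powers `x ^ i` for `i < 2 ^ n`. -/
noncomputable def dyadicMean (x : E →L[ℝ] E) : ℕ → (E →L[ℝ] E)
  | 0 => 1
  | n + 1 => (1 / 2 : ℝ) • ((1 + x ^ 2 ^ n) * dyadicMean x n)

lemma ContinuousLinearMap.norm_one_le : ‖(1 : E →L[ℝ] E)‖ ≤ 1 := ContinuousLinearMap.norm_id_le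

lemma norm_mul_le_one {x y : E →L[ℝ] E} (hx : ‖x‖ ≤ 1) (hy : ‖y‖ ≤ 1) : ‖x * y‖ ≤ 1 :=
  (norm_mul_le _ _).trans (mul_le_one₀ hx (norm_nonneg _) hy)

lemma norm_pow_le_one {x : E →L[ℝ] E} (hx : ‖x‖ ≤ 1) (k : ℕ) : ‖x ^ k‖ ≤ 1 := by
  induction k with
  | zero => simpa using ContinuousLinearMap.norm_one_le
  | succ k ih => rw [pow_succ]; exact norm_mul_le_one ih hx

lemma norm_one_sub_pow_le {x : E →L[ℝ] E} (hx : ‖x‖ ≤ 1) (k : ℕ) : ‖1 - x ^ k‖ ≤ 2 :=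
  (norm_sub_le _ _).trans (by
    linarith [norm_pow_le_one hx k, ContinuousLinearMap.norm_one_le (E := E)])

lemma norm_mul_le_left {x y : E →L[ℝ] E} (hx : ‖x‖ ≤ 1) : ‖x * y‖ ≤ ‖y‖ :=
  (norm_mul_le _ _).trans (mul_le_of_le_one_left (norm_nonneg _) hx)

lemma norm_mul_le_right {x y : E →L[ℝ] E} (hy : ‖y‖ ≤ 1) : ‖x * y‖ ≤ ‖x‖ :=
  (norm_mul_le _ _).trans (mul_le_of_le_one_right (norm_nonneg _) hy)

lemma norm_apply_le_of_norm_le_one {x : E →L[ℝ] E} (hx : ‖x‖ ≤ 1) (v : E) : ‖x v‖ ≤ ‖v‖ :=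
  (x.le_opNorm v).trans (mul_le_of_le_one_left (norm_nonneg _) hx)

lemma norm_dyadicMean_le {x : E →L[ℝ] E} (hx : ‖x‖ ≤ 1) (n : ℕ) : ‖dyadicMean x n‖ ≤ 1 := by
  induction n with
  | zero => exact ContinuousLinearMap.norm_one_le
  | succ n ih =>
    have h1 : ‖1 + x ^ 2 ^ n‖ ≤ 2 := (norm_add_le _ _).trans (by
      linarith [norm_pow_le_one hx (2 ^ n), ContinuousLinearMap.norm_one_le (E := E)])
    have h2 := (norm_mul_le (1 + x ^ 2 ^ n) (dyadicMean x n)).trans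
      (mul_le_mul h1 ih (norm_nonneg _) zero_le_two)
    rw [dyadicMean, norm_smul, Real.norm_of_nonneg (by norm_num)]
    linarith

lemma Commute.dyadicMean_left {x y : E →L[ℝ] E} (h : Commute x y) (n : ℕ) :
    Commute (dyadicMean x n) y := by
  induction n with
  | zero => exact Commute.one_left _
  | succ n ih =>
    exact (((Commute.one_left y).add_left (h.pow_left _)).mul_left ih).smul_left _

lemma Commute.dyadicMean_right {x y : E →L[ℝ] E} (h : Commute x y) (n : ℕ) :
    Commute x (dyadicMean y n) := (h.symm.dyadicMean_left n).symm

lemma Commute.dyadicMean_dyadicMean {x y : E →L[ℝ] E} (h : Commute x y) (m n : ℕ) :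
    Commute (dyadicMean x m) (dyadicMean y n) := (h.dyadicMean_left m).dyadicMean_right n

/-- Each factor `1 + x ^ 2 ^ j` of the mean turns `1 - x ^ 2 ^ j` into `1 - x ^ 2 ^ (j + 1)`, at the
price of `1 / 2`. -/
lemma dyadicMean_mul_one_sub_pow (x : E →L[ℝ] E) (b k : ℕ) :
    dyadicMean x (b + k) * (1 - x ^ 2 ^ b) =
      (1 / 2 : ℝ) ^ k • (dyadicMean x b * (1 - x ^ 2 ^ (b + k))) := by
  induction k with
  | zero => simp
  | succ k ih =>
    have hc : Commute (dyadicMean x b) (1 + x ^ 2 ^ (b + k)) :=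
      (Commute.one_right _).add_right (((Commute.refl x).dyadicMean_left b).pow_right _)
    rw [← add_assoc, dyadicMean, smul_mul_assoc, mul_assoc, ih, mul_smul_comm, smul_smul,
      pow_succ, mul_comm (1 / 2 : ℝ), ← mul_assoc, ← hc.eq, mul_assoc]
    congr 2
    rw [pow_succ 2 (b + k), pow_mul, sq]
    noncomm_ring

lemma norm_dyadicMean_mul_one_sub_pow_le {x : E →L[ℝ] E} (hx : ‖x‖ ≤ 1) (b k : ℕ) :
    ‖dyadicMean x (b + k) * (1 - x ^ 2 ^ b)‖ ≤ (1 / 2 : ℝ) ^ k * 2 := by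
  rw [dyadicMean_mul_one_sub_pow, norm_smul, Real.norm_of_nonneg (by positivity)]
  gcongr
  exact (norm_mul_le_left (norm_dyadicMean_le hx b)).trans (norm_one_sub_pow_le hx _)

lemma dyadicMean_sub_dyadicMean_succ (x : E →L[ℝ] E) (n : ℕ) :
    dyadicMean x n - dyadicMean x (n + 1) = (1 / 2 : ℝ) • (dyadicMean x n * (1 - x ^ 2 ^ n)) := by
  have hc : Commute (dyadicMean x n) (x ^ 2 ^ n) :=
    ((Commute.refl x).dyadicMean_left n).pow_right _
  rw [dyadicMean, add_mul, ← hc.eq, mul_sub, one_mul, mul_one]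
  module

/-- Telescoping over scales: consecutive means differ by half of `dyadicMean x j * (1 - x ^ 2 ^ j)`,
the quantity that the Heisenberg decay controls. -/
lemma norm_mul_dyadicMean_sub_le {x T : E →L[ℝ] E} {η : ℝ} (c k : ℕ)
    (h : ∀ j, c ≤ j → j < c + k → ‖T * (dyadicMean x j * (1 - x ^ 2 ^ j))‖ ≤ η) :
    ‖T * (dyadicMean x c - dyadicMean x (c + k))‖ ≤ k * η := by
  induction k with
  | zero => simp
  | succ k ih =>
    have h1 := ih fun j hj hj' => h j hj (by omega)
    have h2 := h (c + k) (by omega) (by omega)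
    have h3 : T * (dyadicMean x c - dyadicMean x (c + (k + 1))) =
        T * (dyadicMean x c - dyadicMean x (c + k)) +
          (1 / 2 : ℝ) • (T * (dyadicMean x (c + k) * (1 - x ^ 2 ^ (c + k)))) := by
      rw [← mul_smul_comm, ← dyadicMean_sub_dyadicMean_succ, ← mul_add, ← add_assoc]
      congr 1
      abel
    rw [h3]
    refine (norm_add_le _ _).trans ?_
    rw [norm_smul, Real.norm_of_nonneg (by norm_num)]
    push_cast
    have := norm_nonneg (T * (dyadicMean x (c + k) * (1 - x ^ 2 ^ (c + k))))
    linarith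

lemma dyadicMean_add (x : E →L[ℝ] E) (hx : ‖x‖ ≤ 1) (b k : ℕ) :
    ∃ R : E →L[ℝ] E, ‖R‖ ≤ 1 ∧ dyadicMean x (b + k) = R * dyadicMean x b := by
  induction k with
  | zero => exact ⟨1, ContinuousLinearMap.norm_one_le, by simp⟩
  | succ k ih =>
    obtain ⟨R, hR, h⟩ := ih
    refine ⟨(1 / 2 : ℝ) • ((1 + x ^ 2 ^ (b + k)) * R), ?_, ?_⟩
    · have h1 : ‖1 + x ^ 2 ^ (b + k)‖ ≤ 2 := (norm_add_le _ _).trans (by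
        linarith [norm_pow_le_one hx (2 ^ (b + k)), ContinuousLinearMap.norm_one_le (E := E)])
      have h2 := (norm_mul_le (1 + x ^ 2 ^ (b + k)) R).trans
        (mul_le_mul h1 hR (norm_nonneg _) zero_le_two)
      rw [norm_smul, Real.norm_of_nonneg (by norm_num)]
      linarith
    · rw [← add_assoc, dyadicMean, h, smul_mul_assoc, mul_assoc]

lemma pow_mul_eq_of_twist {x y w : E →L[ℝ] E} (h : y * x = w * x * y)
    (k : ℕ) : y * x ^ k = (w * x) ^ k * y := by
  induction k with
  | zero => simp
  | succ k ih => rw [pow_succ, ← mul_assoc, ih, mul_assoc, h, ← mul_assoc, pow_succ]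

lemma mul_dyadicMean_of_twist {x y w : E →L[ℝ] E} (h : y * x = w * x * y)
    (n : ℕ) : y * dyadicMean x n = dyadicMean (w * x) n * y := by
  induction n with
  | zero => simp [dyadicMean]
  | succ n ih =>
    rw [dyadicMean, dyadicMean, mul_smul_comm, ← mul_assoc, mul_add, mul_one,
      pow_mul_eq_of_twist h, smul_mul_assoc, mul_assoc, ← ih]
    congr 1

lemma twist_pow_left {x y z : E →L[ℝ] E} (h : y * x = z * x * y) (hzy : Commute z y) (k : ℕ) :
    y ^ k * x = z ^ k * x * y ^ k := by
  induction k with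
  | zero => simp
  | succ k ih =>
    rw [pow_succ, mul_assoc, h, mul_assoc, ← mul_assoc, ← (hzy.pow_right k).eq, mul_assoc,
      ← mul_assoc (y ^ k), ih, pow_succ z, ← (Commute.self_pow z k).eq]
    simp only [mul_assoc]

/-- Peeling off the last factor leaves a contraction applied to the previous difference, plus one
error term per scale. The error keeps the mean of `x` in front of `1 - w ^ 2 ^ i`, so that bounds
already known for such products can be fed back in `decay_step`. -/
lemma norm_dyadicMean_twist_sub_le {x w : E →L[ℝ] E} (hx : ‖x‖ ≤ 1) (hw : ‖w‖ ≤ 1)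
    (hwx : Commute w x) (v : E) (n : ℕ) :
    ‖(dyadicMean (w * x) n - dyadicMean x n) v‖ ≤
      ∑ i ∈ Finset.range n, 1 / 2 * ‖(dyadicMean x i * (1 - w ^ 2 ^ i) : E →L[ℝ] E) v‖ := by
  induction n with
  | zero => simp [dyadicMean]
  | succ n ih =>
    rw [Finset.sum_range_succ]
    have hwx' : ‖w * x‖ ≤ 1 := norm_mul_le_one hw hx
    have hc : Commute (1 - w ^ 2 ^ n) (dyadicMean x n) :=
      (Commute.one_left _).sub_left ((hwx.dyadicMean_right n).pow_left _)
    have hid : dyadicMean (w * x) (n + 1) - dyadicMean x (n + 1) =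
        (1 / 2 : ℝ) • ((1 + (w * x) ^ 2 ^ n) * (dyadicMean (w * x) n - dyadicMean x n)) -
        (1 / 2 : ℝ) • (x ^ 2 ^ n * (dyadicMean x n * (1 - w ^ 2 ^ n))) := by
      rw [dyadicMean, dyadicMean, ← smul_sub, ← smul_sub, ← hc.eq, hwx.mul_pow,
        (hwx.pow_pow _ _).eq]
      congr 1
      noncomm_ring
    rw [hid, sub_apply]
    refine (norm_sub_le _ _).trans (add_le_add (le_trans ?_ ih) ?_)
    · rw [smul_apply, norm_smul, Real.norm_of_nonneg (by norm_num),
        mul_apply_eq_comp]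
      have h1 : ‖1 + (w * x) ^ 2 ^ n‖ ≤ 2 := (norm_add_le _ _).trans (by
        linarith [norm_pow_le_one hwx' (2 ^ n), ContinuousLinearMap.norm_one_le (E := E)])
      have h2 := (1 + (w * x) ^ 2 ^ n).le_of_opNorm_le h1
        ((dyadicMean (w * x) n - dyadicMean x n) v)
      linarith
    · rw [smul_apply, norm_smul, Real.norm_of_nonneg (by norm_num),
        mul_apply_eq_comp]
      gcongr
      exact norm_apply_le_of_norm_le_one (norm_pow_le_one hx _) _

end DyadicMean

/-! ### One step of the decay in the Heisenberg group -/

section HeisenbergDecay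

variable {E : Type*} [NormedAddCommGroup E] [NormedSpace ℝ E]

/-- A quantitative form of uniform convexity at one scale: vectors of norm at most `μ` whose
midpoint has norm larger than `μ / L ^ 2` are `μ / 2 ^ 20`-close. -/
def IsRound (E : Type*) [NormedAddCommGroup E] (L : ℝ) : Prop :=
  ∀ (u v : E) (μ : ℝ), ‖u‖ ≤ μ → ‖v‖ ≤ μ → 2 * μ < L ^ 2 * ‖u + v‖ → ‖u - v‖ ≤ μ / 2 ^ 20

lemma norm_pow_apply_sub_le {q : E →L[ℝ] E} (hq : ‖q‖ ≤ 1) (u : E) (k : ℕ) :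
    ‖(q ^ k) u - u‖ ≤ k * ‖q u - u‖ := by
  induction k with
  | zero => simp
  | succ k ih =>
    have : (q ^ (k + 1)) u - u = (q ^ k) (q u - u) + ((q ^ k) u - u) := by
      rw [pow_succ, mul_apply_eq_comp, map_sub]; abel
    rw [this]
    refine (norm_add_le _ _).trans ?_
    have := norm_apply_le_of_norm_le_one (norm_pow_le_one hq k) (q u - u)
    rw [Nat.cast_succ]
    linarith

lemma norm_commutator_apply_sub_le {q t ζ : E →L[ℝ] E} (hq : ‖q‖ ≤ 1) (ht : ‖t‖ ≤ 1)
    (hζ : ‖ζ‖ ≤ 1) (h : t * q = ζ * q * t) (u : E) :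
    ‖ζ u - u‖ ≤ 2 * ‖q u - u‖ + 2 * ‖t u - u‖ := by
  have h' : t (q u) = ζ (q (t u)) := DFunLike.congr_fun h u
  have h1 : ζ u - u = -(ζ (q u - u)) - ζ (q (t u - u)) + t (q u - u) + (t u - u) := by
    simp only [map_sub, h']; abel
  have h2 := norm_apply_le_of_norm_le_one hζ (q u - u)
  have h3 := (norm_apply_le_of_norm_le_one hζ (q (t u - u))).trans
    (norm_apply_le_of_norm_le_one hq _)
  have h4 := norm_apply_le_of_norm_le_one ht (q u - u)
  rw [h1]
  refine (norm_add₃_le).trans ?_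
  have := norm_sub_le (-(ζ (q u - u))) (ζ (q (t u - u)))
  rw [norm_neg] at this
  linarith

lemma twist_pow_pow {x y z : E →L[ℝ] E} (h : y * x = z * x * y) (hzx : Commute z x)
    (hzy : Commute z y) (j k : ℕ) : y ^ j * x ^ k = z ^ (j * k) * x ^ k * y ^ j := by
  rw [pow_mul_eq_of_twist (twist_pow_left h hzy j), (hzx.pow_left j).mul_pow, pow_mul]

/-- The ratio `4 / (3 * L)` is at least `19 / 15`, so the geometric sum is at most `15 / 4` times
its next term. The 15 extra scales on the right win, as `15 / 4 * (3 / 4) ^ 15 < 51 / 1000`. -/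
lemma geom_bound {L S : ℝ} (hL0 : 1 < L) (hL : L ≤ 20 / 19) (hS0 : 0 ≤ S) (a β : ℕ) :
    ∑ i ∈ Finset.range a, S * L⁻¹ ^ i * (4 / 3 : ℝ) ^ (β + i) ≤
      51 / 1000 * (S * L⁻¹ ^ a * (4 / 3 : ℝ) ^ (a + 15 + β)) := by
  have hL' : 19 / 20 ≤ L⁻¹ := by
    rw [le_inv_comm₀ (by norm_num) (by linarith)]; norm_num; linarith
  set r : ℝ := L⁻¹ * (4 / 3) with hr
  have hr1 : 19 / 15 ≤ r := by rw [hr]; linarith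
  have hsum : ∑ i ∈ Finset.range a, r ^ i ≤ 15 / 4 * r ^ a := by
    rw [geom_sum_eq (by linarith), div_le_iff₀ (by linarith)]
    have : 0 < r ^ a := by positivity
    nlinarith
  have h1 : ∀ i, S * L⁻¹ ^ i * (4 / 3 : ℝ) ^ (β + i) = S * (4 / 3) ^ β * r ^ i := by
    intro i; rw [hr, mul_pow, pow_add]; ring
  have h2 : S * L⁻¹ ^ a * (4 / 3 : ℝ) ^ (a + 15 + β) =
      S * (4 / 3) ^ β * r ^ a * (4 / 3) ^ 15 := by
    rw [hr, mul_pow, pow_add, pow_add]; ring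
  simp_rw [h1, ← Finset.mul_sum]
  rw [h2]
  have h3 : 0 ≤ S * (4 / 3 : ℝ) ^ β := by positivity
  calc S * (4 / 3) ^ β * ∑ i ∈ Finset.range a, r ^ i
      ≤ S * (4 / 3) ^ β * (15 / 4 * r ^ a) := by gcongr
    _ ≤ _ := by
      have h4 : 0 ≤ S * (4 / 3 : ℝ) ^ β * r ^ a := by positivity
      nlinarith

-- If the bound fails, `u` hardly shrinks when averaged with `q u`, so roundness makes it almost
-- fixed by `q`, hence by `q ^ 2 ^ 15`. It is also almost fixed by `t`, and the commutator of the
-- two is `ζ`. As `u` carries a factor `1 - ζ`, its norm is then at most `0.76 * μ`, too small for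
-- the failure.
set_option maxHeartbeats 1000000 in
lemma decay_step {x y z : E →L[ℝ] E} (hx : ‖x‖ ≤ 1) (hy : ‖y‖ ≤ 1) (hz : ‖z‖ ≤ 1)
    (h : y * x = z * x * y) (hzx : Commute z x) (hzy : Commute z y)
    {L S : ℝ} (hL0 : 1 < L) (hL : L ≤ 20 / 19) (hround : IsRound E L) (hS0 : 0 ≤ S)
    (a β k e : ℕ)
    (hS : ∀ j ≤ a, ∀ (i : ℕ) (v : E), ‖(dyadicMean x j * (dyadicMean y (β + k) *
      dyadicMean z e * (1 - z ^ 2 ^ i)) : E →L[ℝ] E) v‖ ≤ S * L⁻¹ ^ j * (4 / 3) ^ i * ‖v‖)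
    (hk : 4 * (1 / 2 : ℝ) ^ k ≤ 1 / 100 * (S * L⁻¹ ^ a * (4 / 3) ^ (a + 15 + β)))
    {ξ : E} (hξ : ‖ξ‖ ≤ 1) :
    L ^ 2 * ‖(dyadicMean x (a + 1) * (dyadicMean y (β + k) *
      dyadicMean z e * (1 - z ^ 2 ^ (a + 15 + β))) : E →L[ℝ] E) ξ‖ ≤
      S * L⁻¹ ^ a * (4 / 3) ^ (a + 15 + β) := by
  set c := a + 15 + β with hc
  set μ := S * L⁻¹ ^ a * (4 / 3 : ℝ) ^ c with hμ
  set Y := dyadicMean y (β + k)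
  set Z := dyadicMean z e
  set ζ := z ^ 2 ^ c with hζd
  set t := y ^ 2 ^ β with ht
  set q := x ^ 2 ^ a with hq
  have hL1 : 0 < L⁻¹ := by positivity
  have hμ0 : 0 ≤ μ := by positivity
  have hY : ‖Y‖ ≤ 1 := norm_dyadicMean_le hy _
  have hZ : ‖Z‖ ≤ 1 := norm_dyadicMean_le hz _
  have htn : ‖t‖ ≤ 1 := norm_pow_le_one hy _
  have hqn : ‖q‖ ≤ 1 := norm_pow_le_one hx _
  have hζn : ‖ζ‖ ≤ 1 := norm_pow_le_one hz _
  have hXn : ‖dyadicMean x a‖ ≤ 1 := norm_dyadicMean_le hx _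
  set u := (dyadicMean x a * (Y * Z * (1 - ζ))) ξ with hu
  have hunorm : ‖u‖ ≤ μ := by
    refine (hS a le_rfl c ξ).trans ?_
    exact mul_le_of_le_one_right hμ0 hξ
  have hsucc : (dyadicMean x (a + 1) * (Y * Z * (1 - ζ))) ξ = (1 / 2 : ℝ) • (u + q u) := by
    rw [dyadicMean, hu]
    simp [mul_apply_eq_comp, hq]
  rw [hsucc]
  by_contra! hcon
  have hhalf : ‖(1 / 2 : ℝ) • (u + q u)‖ = 1 / 2 * ‖u + q u‖ := by
    rw [norm_smul, Real.norm_of_nonneg (by norm_num)]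
  rw [hhalf] at hcon
  have hqu : ‖q u‖ ≤ ‖u‖ := norm_apply_le_of_norm_le_one hqn u
  have hclose : ‖q u - u‖ ≤ μ / 2 ^ 20 := by
    rw [norm_sub_rev]
    exact hround u (q u) μ hunorm (hqu.trans hunorm) (by linarith)
  have hcζZ : ∀ i : ℕ, Commute (1 - z ^ i) Z := fun i =>
    (Commute.one_left _).sub_left (((Commute.refl z).dyadicMean_right e).pow_left i)
  have hcζY : ∀ i : ℕ, Commute (1 - z ^ i) Y := fun i =>
    (Commute.one_left _).sub_left ((hzy.dyadicMean_right _).pow_left i)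
  have htY : Commute t Y := ((Commute.refl y).dyadicMean_right _).pow_left _
  have htZ : Commute t Z := (hzy.symm.dyadicMean_right _).pow_left _
  have htζ : Commute t (1 - ζ) := (Commute.one_right _).sub_right (hzy.symm.pow_pow _ _)
  have htW : t * (Y * Z * (1 - ζ)) = (Y * Z * (1 - ζ)) * t :=
    ((htY.mul_right htZ).mul_right htζ).eq
  -- Moving `t` to the right through the mean of `x` twists `x` by `z ^ 2 ^ β`. The displacement of
  -- `u` thus splits into the cost of the twist and a term with `Y * (1 - t)`, small because `Y`
  -- averages over a much longer stretch.
  have htu : t u = dyadicMean (z ^ 2 ^ β * x) a ((Y * Z * (1 - ζ)) (t ξ)) := by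
    have h1 : t * (dyadicMean x a * (Y * Z * (1 - ζ))) =
        dyadicMean (z ^ 2 ^ β * x) a * ((Y * Z * (1 - ζ)) * t) := by
      rw [← mul_assoc, mul_dyadicMean_of_twist (twist_pow_left h hzy _), mul_assoc, htW]
    exact DFunLike.congr_fun h1 ξ
  have hsplit : t u - u = (dyadicMean (z ^ 2 ^ β * x) a - dyadicMean x a : E →L[ℝ] E)
      ((Y * Z * (1 - ζ)) (t ξ)) - dyadicMean x a ((Y * (1 - t) * (Z * (1 - ζ))) ξ) := by
    have h1 : (Y * (1 - t) * (Z * (1 - ζ))) = (Y * Z * (1 - ζ)) - (Y * Z * (1 - ζ)) * t := by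
      rw [mul_sub, sub_mul, mul_one, mul_assoc Y t, (htZ.mul_right htζ).eq]
      simp only [mul_assoc]
    rw [htu, h1, hu]
    simp only [mul_apply_eq_comp, sub_apply, map_sub]
    abel
  have hfirst : ‖(dyadicMean (z ^ 2 ^ β * x) a - dyadicMean x a : E →L[ℝ] E)
      ((Y * Z * (1 - ζ)) (t ξ))‖ ≤ 51 / 1000 * μ := by
    refine (norm_dyadicMean_twist_sub_le hx (norm_pow_le_one hz _) (hzx.pow_left _) _ _).trans
      (le_trans (Finset.sum_le_sum fun i hi => ?_) (geom_bound hL0 hL hS0 a β))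
    -- The `i`-th error is again of the form bounded by `hS`, at scales `i` and `β + i`, applied to
    -- a vector of norm at most 2.
    have hid : (dyadicMean x i * (1 - (z ^ 2 ^ β) ^ 2 ^ i) : E →L[ℝ] E) ((Y * Z * (1 - ζ)) (t ξ)) =
        (dyadicMean x i * (Y * Z * (1 - z ^ 2 ^ (β + i))) : E →L[ℝ] E) ((1 - ζ) (t ξ)) := by
      have : (1 - z ^ 2 ^ (β + i)) * (Y * Z * (1 - ζ)) =
          Y * Z * (1 - z ^ 2 ^ (β + i)) * (1 - ζ) := by
        rw [← mul_assoc, (((hcζY _).mul_right (hcζZ _))).eq]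
      rw [← pow_mul, ← pow_add]
      have h2 := congrArg (fun W : E →L[ℝ] E => dyadicMean x i (W (t ξ))) this
      simpa only [mul_apply_eq_comp] using h2
    rw [hid]
    have h3 := hS i (Finset.mem_range.1 hi).le (β + i) ((1 - ζ) (t ξ))
    have h4 : ‖(1 - ζ) (t ξ)‖ ≤ 2 := by
      have h5 := (1 - ζ).le_of_opNorm_le (norm_one_sub_pow_le hz _) (t ξ)
      have h6 := (norm_apply_le_of_norm_le_one htn ξ).trans hξ
      linarith
    have h7 : 0 ≤ S * L⁻¹ ^ i * (4 / 3 : ℝ) ^ (β + i) := by positivity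
    nlinarith
  have hsecond : ‖dyadicMean x a ((Y * (1 - t) * (Z * (1 - ζ))) ξ)‖ ≤ 1 / 100 * μ := by
    refine (norm_apply_le_of_norm_le_one hXn _).trans (le_trans ?_ hk)
    have h1 := norm_dyadicMean_mul_one_sub_pow_le hy β k
    have h2 : ‖Z * (1 - ζ)‖ ≤ 2 := (norm_mul_le_left hZ).trans (norm_one_sub_pow_le hz _)
    have h3 := (norm_mul_le (Y * (1 - t)) (Z * (1 - ζ))).trans
      (mul_le_mul h1 h2 (norm_nonneg _) (by positivity))
    have h4 := (Y * (1 - t) * (Z * (1 - ζ))).le_of_opNorm_le h3 ξ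
    have h5 : 0 ≤ (1 / 2 : ℝ) ^ k * 2 * 2 := by positivity
    nlinarith
  have htu' : ‖t u - u‖ ≤ 61 / 1000 * μ := by
    rw [hsplit]
    refine (norm_sub_le _ _).trans ?_
    linarith
  obtain ⟨N, hN⟩ : ∃ N : ℕ, N = 2 ^ 15 := ⟨_, rfl⟩
  have hq' : ‖(q ^ N) u - u‖ ≤ μ / 32 := by
    refine (norm_pow_apply_sub_le hqn u N).trans ?_
    rw [hN, Nat.cast_pow, Nat.cast_ofNat]
    linarith
  have htwist : t * q ^ N = ζ * q ^ N * t := by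
    rw [hN, ht, hq, ← pow_mul, ← pow_add, twist_pow_pow h hzx hzy, ← pow_add, hζd, hc]
    congr 4
    ring
  have hζu := norm_commutator_apply_sub_le (norm_pow_le_one hqn N) htn hζn htwist u
  have hcζX : Commute ζ (dyadicMean x a) := (hzx.dyadicMean_right a).pow_left _
  -- From `1 - ζ = (1 - ζ²) / 2 + (1 - ζ)² / 2`. The first part lives at scale `c + 1`, where the
  -- bound has grown by `4 / 3` only, instead of 2; the second is small because `ζ` almost fixes
  -- `u`.
  have hfin : u = (1 / 2 : ℝ) • (dyadicMean x a * (Y * Z * (1 - z ^ 2 ^ (c + 1))) : E →L[ℝ] E) ξ -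
      (1 / 2 : ℝ) • (ζ u - u) := by
    have hcζ : Commute ζ (Y * Z) := by
      refine Commute.mul_right ((hzy.dyadicMean_right _).pow_left _)
        (((Commute.refl z).dyadicMean_right e).pow_left _)
    have h1 : ζ * (dyadicMean x a * (Y * Z * (1 - ζ))) =
        dyadicMean x a * (Y * Z * (ζ * (1 - ζ))) := by
      rw [← mul_assoc, hcζX.eq, mul_assoc, ← mul_assoc ζ, hcζ.eq]
      simp only [mul_assoc]
    have h2 : ζ u = (dyadicMean x a * (Y * Z * (ζ * (1 - ζ)))) ξ := by rw [← h1]; rfl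
    have h3 : z ^ 2 ^ (c + 1) = ζ * ζ := by rw [pow_succ 2 c, pow_mul, sq]
    rw [h2, h3, hu]
    have h4 : (1 - ζ : E →L[ℝ] E) = (1 / 2 : ℝ) • (1 - ζ * ζ) -
        (1 / 2 : ℝ) • (ζ * (1 - ζ) - (1 - ζ)) := by
      rw [mul_sub, mul_one]; module
    have h5 := congrArg (fun W : E →L[ℝ] E => (dyadicMean x a * (Y * Z * W)) ξ) h4
    refine h5.trans ?_
    simp only [mul_sub, mul_smul_comm, sub_apply, smul_apply]
  have hbig := hS a le_rfl (c + 1) ξ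
  have hbig' : S * L⁻¹ ^ a * (4 / 3) ^ (c + 1) * ‖ξ‖ ≤ 4 / 3 * μ := by
    rw [hμ, pow_succ]
    have : 0 ≤ S * L⁻¹ ^ a * ((4 / 3 : ℝ) ^ c * (4 / 3)) := by positivity
    nlinarith
  -- Half of `4 / 3`, plus half of `2 / 32 + 2 * 61 / 1000`.
  have hu2 : ‖u‖ ≤ 76 / 100 * μ := by
    have h1 := norm_sub_le ((1 / 2 : ℝ) • (dyadicMean x a * (Y * Z * (1 - z ^ 2 ^ (c + 1))) : E →L[ℝ] E) ξ)
      ((1 / 2 : ℝ) • (ζ u - u))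
    rw [← hfin, norm_smul, norm_smul, Real.norm_of_nonneg (by norm_num)] at h1
    refine h1.trans (le_trans (add_le_add (mul_le_mul_of_nonneg_left (hbig.trans hbig')
      (by norm_num)) (mul_le_mul_of_nonneg_left hζu (by norm_num))) ?_)
    linarith
  have hsum : ‖u + q u‖ ≤ 2 * ‖u‖ := (norm_add_le _ _).trans (by linarith)
  have hL2 : L ^ 2 ≤ 400 / 361 := by nlinarith
  nlinarith [norm_nonneg (u + q u), sq_nonneg L]

end HeisenbergDecay

/-! ### Exponential decay in the Heisenberg group -/

section HeisenbergDecayBound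

variable {E : Type*} [NormedAddCommGroup E] [NormedSpace ℝ E]

lemma norm_heisenberg_trivial_le {x y : E →L[ℝ] E} (hx : ‖x‖ ≤ 1) (hy : ‖y‖ ≤ 1)
    (z : E →L[ℝ] E) (j b e k : ℕ) :
    ‖dyadicMean x j * (dyadicMean y b * dyadicMean z e * (1 - z ^ 2 ^ k))‖ ≤
      ‖dyadicMean z e * (1 - z ^ 2 ^ k)‖ := by
  rw [mul_assoc (dyadicMean y b)]
  exact (norm_mul_le_left (norm_dyadicMean_le hx j)).trans
    (norm_mul_le_left (norm_dyadicMean_le hy b))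

lemma norm_heisenberg_trivial_le_two {x y z : E →L[ℝ] E} (hx : ‖x‖ ≤ 1) (hy : ‖y‖ ≤ 1)
    (hz : ‖z‖ ≤ 1) (j b e k : ℕ) :
    ‖dyadicMean x j * (dyadicMean y b * dyadicMean z e * (1 - z ^ 2 ^ k))‖ ≤ 2 :=
  (norm_heisenberg_trivial_le hx hy z j b e k).trans
    ((norm_mul_le_left (norm_dyadicMean_le hz e)).trans (norm_one_sub_pow_le hz _))

lemma norm_heisenberg_trivial_le_pow {x y z : E →L[ℝ] E} (hx : ‖x‖ ≤ 1) (hy : ‖y‖ ≤ 1)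
    (hz : ‖z‖ ≤ 1) (j b k i : ℕ) :
    ‖dyadicMean x j * (dyadicMean y b * dyadicMean z (k + i) * (1 - z ^ 2 ^ k))‖ ≤
      2 * (1 / 2) ^ i :=
  (norm_heisenberg_trivial_le hx hy z j b _ k).trans
    ((norm_dyadicMean_mul_one_sub_pow_le hz k i).trans (by rw [mul_comm]))

/-- An extremal argument: a near-maximiser of `L ^ j * (3 / 4) ^ k * ‖T j k ξ‖` would contradict
`decay_step`. The weight `3 / 4` lies between `1 / 2` and 1, so the trivial bounds, weighted, peak
at `k = e`; if the claim fails at `(J, e)`, the near-maximiser is within `n` of it, where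
`decay_step` applies. The supremum runs over vectors because roundness is about vectors. -/
lemma heisenberg_decay_aux {x y z : E →L[ℝ] E} (hx : ‖x‖ ≤ 1) (hy : ‖y‖ ≤ 1) (hz : ‖z‖ ≤ 1)
    (h : y * x = z * x * y) (hzx : Commute z x) (hzy : Commute z y)
    {L : ℝ} (hL0 : 1 < L) (hL : L ≤ 20 / 19) (hround : IsRound E L)
    {J b e n : ℕ} (h1 : n + 1 ≤ J) (h2 : J + n + 15 ≤ e) (h3 : e + 3 * n ≤ b + J) :
    ‖dyadicMean x J * (dyadicMean y b * dyadicMean z e * (1 - z ^ 2 ^ e))‖ ≤ 2 * L⁻¹ ^ n := by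
  by_contra! hcon
  have hL00 : 0 < L := by linarith
  have hLi : 0 < L⁻¹ := by positivity
  have hLi' : 19 / 20 ≤ L⁻¹ := by
    rw [le_inv_comm₀ (by norm_num) (by linarith)]; norm_num; linarith
  let T : ℕ → ℕ → E →L[ℝ] E := fun j k =>
    dyadicMean x j * (dyadicMean y b * dyadicMean z e * (1 - z ^ 2 ^ k))
  have hT2 : ∀ j k, ‖T j k‖ ≤ 2 := fun j k => norm_heisenberg_trivial_le_two hx hy hz j b e k
  have hTp : ∀ j k i, k + i = e → ‖T j k‖ ≤ 2 * (1 / 2) ^ i := by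
    rintro j k i rfl
    exact norm_heisenberg_trivial_le_pow hx hy hz j b k i
  change 2 * L⁻¹ ^ n < ‖T J e‖ at hcon
  have hTtriv : ∀ j k, (3 / 4 : ℝ) ^ k * ‖T j k‖ ≤ 2 * (3 / 4) ^ e := by
    intro j k
    rcases le_total e k with hek | hek
    · have h4 : (3 / 4 : ℝ) ^ k ≤ (3 / 4) ^ e :=
        pow_le_pow_of_le_one (by norm_num) (by norm_num) hek
      have := mul_le_mul h4 (hT2 j k) (norm_nonneg _) (by positivity)
      linarith
    · obtain ⟨i, rfl⟩ := Nat.exists_eq_add_of_le hek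
      have h4 := hTp j k i rfl
      have h5 : (1 / 2 : ℝ) ^ i ≤ (3 / 4) ^ i := pow_le_pow_left₀ (by norm_num) (by norm_num) i
      rw [pow_add]
      have h6 : 0 < (3 / 4 : ℝ) ^ k := by positivity
      nlinarith
  set A : Set ℝ := {r | ∃ j ≤ J, ∃ k, ∃ ξ : E, ‖ξ‖ ≤ 1 ∧ r = L ^ j * (3 / 4) ^ k * ‖T j k ξ‖}
    with hA
  have hbound : ∀ j ≤ J, ∀ k, ∀ ξ : E, ‖ξ‖ ≤ 1 →
      L ^ j * (3 / 4) ^ k * ‖T j k ξ‖ ≤ L ^ j * (2 * (3 / 4) ^ e) := by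
    intro j _ k ξ hξ
    rw [mul_assoc]
    refine mul_le_mul_of_nonneg_left (le_trans ?_ (hTtriv j k)) (by positivity)
    gcongr
    exact ((T j k).le_opNorm ξ).trans (mul_le_of_le_one_right (norm_nonneg _) hξ)
  have hbdd : BddAbove A := by
    refine ⟨L ^ J * (2 * (3 / 4) ^ e), ?_⟩
    rintro r ⟨j, hj, k, ξ, hξ, rfl⟩
    refine (hbound j hj k ξ hξ).trans ?_
    gcongr
    exact hL0.le
  set S := sSup A with hSdef
  obtain ⟨ξ₀, hξ₀, hξ₀'⟩ : ∃ ξ : E, ‖ξ‖ ≤ 1 ∧ 2 * L⁻¹ ^ n < ‖T J e ξ‖ := by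
    obtain ⟨ξ, h4, h5⟩ := (T J e).exists_lt_apply_of_lt_opNorm hcon
    exact ⟨ξ, h4.le, h5⟩
  have hSlow : L ^ J * (3 / 4) ^ e * (2 * L⁻¹ ^ n) < S := by
    refine lt_of_lt_of_le ?_ (le_csSup hbdd ⟨J, le_rfl, e, ξ₀, hξ₀, rfl⟩)
    exact mul_lt_mul_of_pos_left hξ₀' (by positivity)
  have hS0 : 0 < S := lt_of_le_of_lt (by positivity) hSlow
  have hne : A.Nonempty := ⟨_, J, le_rfl, e, ξ₀, hξ₀, rfl⟩
  -- Of the factor `L ^ 2` gained in `decay_step`, one `L` pays for the passage from `a` to `a + 1`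
  -- and one for maximising only up to `L`.
  obtain ⟨r, ⟨j, hj, c, ξ, hξ, rfl⟩, hr⟩ :=
    exists_lt_of_lt_csSup hne (show S / L < sSup A from div_lt_self hS0 hL0)
  have hr' : S < L * (L ^ j * (3 / 4) ^ c * ‖T j c ξ‖) := by
    rw [div_lt_iff₀ hL00] at hr; linarith
  have hTξ : ‖T j c ξ‖ ≤ ‖T j c‖ :=
    ((T j c).le_opNorm ξ).trans (mul_le_of_le_one_right (norm_nonneg _) hξ)
  have hLn : L ^ n * L⁻¹ ^ n = 1 := by rw [← mul_pow, mul_inv_cancel₀ hL00.ne', one_pow]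
  -- Here `ρ` is the rate at which the weighted trivial bound drops away from `k = e`: `3 / 4`
  -- above, and `(1 / 2) / (3 / 4) = 2 / 3` below. As `ρ * L ≤ 1`, a distance beyond `n` contradicts
  -- `hSlow`.
  have hgap : ∀ ρ : ℝ, 0 ≤ ρ → ρ ≤ 3 / 4 → (3 / 4 : ℝ) ^ c * ‖T j c‖ ≤
      2 * (3 / 4) ^ e * ρ ^ (n + 1) → False := by
    intro ρ hρ0 hρ hle
    have h4 : L ^ j ≤ L ^ J := pow_le_pow_right₀ hL0.le hj
    have h5 : L * (L ^ j * (3 / 4) ^ c * ‖T j c ξ‖) ≤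
        L * (L ^ J * (2 * (3 / 4) ^ e * ρ ^ (n + 1))) := by
      rw [mul_assoc (L ^ j)]
      exact mul_le_mul_of_nonneg_left (mul_le_mul h4
        ((mul_le_mul_of_nonneg_left hTξ (by positivity)).trans hle) (by positivity)
        (by positivity)) hL00.le
    have h6 := hSlow.trans (hr'.trans_le h5)
    have h7 : (ρ * L) ^ (n + 1) ≤ 1 := pow_le_one₀ (by positivity) (by nlinarith)
    have h8 : L * (L ^ J * (2 * (3 / 4) ^ e * ρ ^ (n + 1))) =
        L ^ J * (3 / 4) ^ e * (2 * L⁻¹ ^ n) * (ρ * L) ^ (n + 1) := by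
      have : L⁻¹ ^ n * (ρ * L) ^ (n + 1) = L * ρ ^ (n + 1) := by
        rw [mul_pow, pow_succ L n]
        linear_combination ρ ^ (n + 1) * L * hLn
      linear_combination -2 * L ^ J * (3 / 4) ^ e * this
    rw [h8] at h6
    have h9 : 0 ≤ L ^ J * (3 / 4) ^ e * (2 * L⁻¹ ^ n) := by positivity
    nlinarith
  have hjlow : J < j + n + 1 := by
    by_contra! hle
    have h4 := hr'.trans_le (mul_le_mul_of_nonneg_left (hbound j hj c ξ hξ) hL00.le)
    have h5 : L ^ (j + n + 1) ≤ L ^ J := pow_le_pow_right₀ hL0.le hle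
    have h6 : L * (L ^ j * (2 * (3 / 4) ^ e)) =
        L ^ (j + n + 1) * (3 / 4) ^ e * (2 * L⁻¹ ^ n) := by
      rw [pow_succ, pow_add]
      linear_combination -2 * L * L ^ j * (3 / 4) ^ e * hLn
    rw [h6] at h4
    have h7 : L ^ (j + n + 1) * (3 / 4) ^ e * (2 * L⁻¹ ^ n) ≤
        L ^ J * (3 / 4) ^ e * (2 * L⁻¹ ^ n) := by gcongr
    linarith
  have hcup : c < e + n + 1 := by
    by_contra! hle
    refine hgap (3 / 4) (by norm_num) le_rfl ?_
    have h4 : (3 / 4 : ℝ) ^ c ≤ (3 / 4) ^ (e + (n + 1)) :=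
      pow_le_pow_of_le_one (by norm_num) (by norm_num) (by omega)
    have h5 := mul_le_mul h4 (hT2 j c) (norm_nonneg _) (by positivity)
    rw [pow_add] at h5
    linarith
  have hclow : e < c + n + 1 := by
    by_contra! hle
    obtain ⟨i, hi⟩ := Nat.exists_eq_add_of_le (show c ≤ e by omega)
    refine hgap (2 / 3) (by norm_num) (by norm_num) ?_
    have h4 := hTp j c i hi.symm
    have h5 : (2 / 3 : ℝ) ^ i ≤ (2 / 3) ^ (n + 1) :=
      pow_le_pow_of_le_one (by norm_num) (by norm_num) (by omega)
    have h6 : (1 / 2 : ℝ) ^ i = (3 / 4) ^ i * (2 / 3) ^ i := by rw [← mul_pow]; norm_num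
    rw [hi, pow_add]
    calc (3 / 4 : ℝ) ^ c * ‖T j c‖ ≤ (3 / 4) ^ c * (2 * ((3 / 4) ^ i * (2 / 3) ^ i)) := by
          rw [← h6]; gcongr
      _ ≤ (3 / 4) ^ c * (2 * ((3 / 4) ^ i * (2 / 3) ^ (n + 1))) := by gcongr
      _ = _ := by ring
  obtain ⟨a, rfl⟩ : ∃ a, j = a + 1 := ⟨j - 1, by omega⟩
  obtain ⟨β, rfl⟩ : ∃ β, c = a + 15 + β := ⟨c - (a + 15), by omega⟩
  obtain ⟨k, rfl⟩ : ∃ k, b = β + k := ⟨b - β, by omega⟩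
  have hkey : ∀ i ≤ J, ∀ (m : ℕ) (v : E), ‖T i m v‖ ≤ S * L⁻¹ ^ i * (4 / 3) ^ m * ‖v‖ := by
    intro i hi m v
    rcases eq_or_ne v 0 with rfl | hv
    · simp
    have hv' : 0 < ‖v‖ := norm_pos_iff.2 hv
    have h4 : L ^ i * (3 / 4) ^ m * ‖T i m (‖v‖⁻¹ • v)‖ ≤ S := by
      refine le_csSup hbdd ⟨i, hi, m, _, ?_, rfl⟩
      rw [norm_smul, norm_inv, norm_norm, inv_mul_cancel₀ hv'.ne']
    rw [map_smul, norm_smul, norm_inv, norm_norm] at h4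
    have h5 : ‖T i m v‖ = L⁻¹ ^ i * (4 / 3) ^ m * ‖v‖ *
        (L ^ i * (3 / 4) ^ m * (‖v‖⁻¹ * ‖T i m v‖)) := by
      have h6 : L ^ i * L⁻¹ ^ i = 1 := by rw [← mul_pow, mul_inv_cancel₀ hL00.ne', one_pow]
      have h7 : (3 / 4 : ℝ) ^ m * (4 / 3) ^ m = 1 := by rw [← mul_pow]; norm_num
      have h8 : ‖v‖ * ‖v‖⁻¹ = 1 := mul_inv_cancel₀ hv'.ne'
      calc ‖T i m v‖ = (L ^ i * L⁻¹ ^ i) * ((3 / 4 : ℝ) ^ m * (4 / 3) ^ m) *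
            (‖v‖ * ‖v‖⁻¹) * ‖T i m v‖ := by rw [h6, h7, h8]; ring
        _ = _ := by ring
    rw [h5]
    calc _ ≤ L⁻¹ ^ i * (4 / 3) ^ m * ‖v‖ * S := by gcongr
      _ = _ := by ring
  have hk : 4 * (1 / 2 : ℝ) ^ k ≤ 1 / 100 * (S * L⁻¹ ^ a * (4 / 3) ^ (a + 15 + β)) := by
    have h4 : (1 / 2 : ℝ) ^ k ≤ (1 / 2) ^ (n + 8) :=
      pow_le_pow_of_le_one (by norm_num) (by norm_num) (by omega)
    have h5 : (1 / 2 : ℝ) ^ n ≤ (L⁻¹ * (3 / 4)) ^ n :=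
      pow_le_pow_left₀ (by norm_num) (by linarith) n
    have h6 : 2 * (L⁻¹ * (3 / 4)) ^ n ≤ S * L⁻¹ ^ a * (4 / 3) ^ (a + 15 + β) := by
      have h7 : L⁻¹ ^ J ≤ L⁻¹ ^ a :=
        pow_le_pow_of_le_one hLi.le (inv_le_one_of_one_le₀ hL0.le) (by omega)
      have h8 : (4 / 3 : ℝ) ^ e ≤ (4 / 3) ^ (a + 15 + β + n) :=
        pow_le_pow_right₀ (by norm_num) (by omega)
      have h9 : L ^ J * L⁻¹ ^ J = 1 := by rw [← mul_pow, mul_inv_cancel₀ hL00.ne', one_pow]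
      have h10 : (3 / 4 : ℝ) ^ e * (4 / 3) ^ e = 1 := by rw [← mul_pow]; norm_num
      have h11 : (3 / 4 : ℝ) ^ n * (4 / 3) ^ n = 1 := by rw [← mul_pow]; norm_num
      calc 2 * (L⁻¹ * (3 / 4)) ^ n
          = (L ^ J * (3 / 4) ^ e * (2 * L⁻¹ ^ n)) * L⁻¹ ^ J * ((3 / 4) ^ n * (4 / 3) ^ e) := by
            rw [mul_pow]
            linear_combination (-2 * L⁻¹ ^ n * (3 / 4) ^ n) * h9 -
              2 * L⁻¹ ^ n * (3 / 4) ^ n * (L ^ J * L⁻¹ ^ J) * h10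
        _ ≤ S * L⁻¹ ^ a * ((3 / 4) ^ n * (4 / 3) ^ (a + 15 + β + n)) := by gcongr
        _ = S * L⁻¹ ^ a * (4 / 3) ^ (a + 15 + β) := by
            rw [pow_add _ (a + 15 + β) n]
            linear_combination (S * L⁻¹ ^ a * (4 / 3) ^ (a + 15 + β)) * h11
    rw [pow_add] at h4
    have h12 : (0 : ℝ) < (1 / 2) ^ n := by positivity
    linarith
  have hfin := decay_step hx hy hz h hzx hzy hL0 hL hround hS0.le a β k e
    (fun i hi m v => hkey i (by omega) m v) hk hξ
  change L ^ 2 * ‖T (a + 1) (a + 15 + β) ξ‖ ≤ _ at hfin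
  set c := a + 15 + β
  have h6 : L ^ a * L⁻¹ ^ a = 1 := by rw [← mul_pow, mul_inv_cancel₀ hL00.ne', one_pow]
  have h7 : (3 / 4 : ℝ) ^ c * (4 / 3) ^ c = 1 := by rw [← mul_pow]; norm_num
  have h8 : L * (L ^ (a + 1) * (3 / 4) ^ c * ‖T (a + 1) c ξ‖) =
      L ^ a * (3 / 4) ^ c * (L ^ 2 * ‖T (a + 1) c ξ‖) := by ring
  have h9 : L ^ a * (3 / 4) ^ c * (L ^ 2 * ‖T (a + 1) c ξ‖) ≤
      L ^ a * (3 / 4) ^ c * (S * L⁻¹ ^ a * (4 / 3) ^ c) := by gcongr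
  have h10 : L ^ a * (3 / 4) ^ c * (S * L⁻¹ ^ a * (4 / 3) ^ c) = S := by
    linear_combination S * (3 / 4) ^ c * (4 / 3) ^ c * h6 + S * h7
  linarith

/-- Exponential decay for products of dyadic means in the Heisenberg group. -/
theorem heisenberg_decay {x y z : E →L[ℝ] E} (hx : ‖x‖ ≤ 1) (hy : ‖y‖ ≤ 1) (hz : ‖z‖ ≤ 1)
    (h : y * x = z * x * y) (hzx : Commute z x) (hzy : Commute z y)
    {L : ℝ} (hL0 : 1 < L) (hL : L ≤ 20 / 19) (hround : IsRound E L)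
    {a b e n : ℕ} (hn : 15 ≤ n) (ha : 5 * n ≤ a) (hb : 5 * n ≤ b) (he : 5 * n ≤ e)
    (hab : e + 3 * n ≤ a + b) :
    ‖dyadicMean x a * (dyadicMean y b * dyadicMean z e * (1 - z ^ 2 ^ e))‖ ≤ 2 * L⁻¹ ^ n := by
  -- The auxiliary bound needs the scale of `x` to stay `n + 15` below `e`. A longer mean is a
  -- contraction times a shorter one, so `a` can be lowered.
  obtain ⟨k, hk⟩ := Nat.exists_eq_add_of_le (min_le_left a (e - 2 * n))
  obtain ⟨R, hR, hRa⟩ := dyadicMean_add x hx (min a (e - 2 * n)) k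
  rw [hk, hRa, mul_assoc]
  exact (norm_mul_le_left hR).trans (heisenberg_decay_aux hx hy hz h hzx hzy hL0 hL hround
    (by omega) (by omega) (by omega))

end HeisenbergDecayBound

/-- `x` and `y` generate a quotient of the Heisenberg group with commutator `z` or `z⁻¹`. -/
structure HeisenbergTriple {G : Type*} [Group G] (x z y : G) : Prop where
  comm_left : Commute z x
  comm_right : Commute z y
  rel : y * x = z * x * y ∨ x * y = z * y * x

lemma HeisenbergTriple.symm {G : Type*} [Group G] {x z y : G} (h : HeisenbergTriple x z y) :
    HeisenbergTriple y z x := ⟨h.comm_right, h.comm_left, h.rel.symm⟩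

/-! ### Changing and exchanging means in a representation -/

section Representation

variable {E : Type*} [NormedAddCommGroup E] [NormedSpace ℝ E]

/-- The powers `z ^ i`, `i < 2 ^ n`, are those of the inverse shifted by `z ^ (2 ^ n - 1)`. This
makes the estimates insensitive to whether the commutator is `z` or its inverse. -/
lemma dyadicMean_eq_of_mul_eq_one {z z' : E →L[ℝ] E} (h : z * z' = 1) (h' : z' * z = 1)
    (n : ℕ) : ∃ k, dyadicMean z n = dyadicMean z' n * z ^ k := by
  have hc : Commute z z' := h.trans h'.symm
  induction n with
  | zero => exact ⟨0, by simp [dyadicMean]⟩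
  | succ n ih =>
    obtain ⟨k, hk⟩ := ih
    refine ⟨2 ^ n + k, ?_⟩
    have h1 : (1 + z ^ 2 ^ n : E →L[ℝ] E) = (1 + z' ^ 2 ^ n) * z ^ 2 ^ n := by
      rw [add_mul, one_mul, ← hc.symm.mul_pow, h', one_pow, add_comm]
    rw [dyadicMean, dyadicMean, hk, h1, smul_mul_assoc, pow_add]
    congr 1
    rw [mul_assoc, mul_assoc, ← mul_assoc (z ^ 2 ^ n), ((hc.dyadicMean_right n).pow_left _).eq]
    simp only [mul_assoc]

lemma norm_mul_dyadicMean_inv_le {z z' : E →L[ℝ] E} (hz : ‖z‖ ≤ 1) (h : z * z' = 1)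
    (h' : z' * z = 1) (T : E →L[ℝ] E) (e : ℕ) :
    ‖T * (dyadicMean z e * (1 - z ^ 2 ^ e))‖ ≤
      ‖T * (dyadicMean z' e * (1 - z' ^ 2 ^ e))‖ := by
  have hc : Commute z z' := h.trans h'.symm
  obtain ⟨k, hk⟩ := dyadicMean_eq_of_mul_eq_one h h' e
  have h1 : (1 - z ^ 2 ^ e : E →L[ℝ] E) = -((1 - z' ^ 2 ^ e) * z ^ 2 ^ e) := by
    rw [sub_mul, one_mul, ← hc.symm.mul_pow, h', one_pow, neg_sub]
  have h2 : Commute (z ^ k) (1 - z' ^ 2 ^ e) :=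
    (Commute.one_right _).sub_right (hc.pow_pow _ _)
  have h3 : T * (dyadicMean z e * (1 - z ^ 2 ^ e)) =
      -(T * (dyadicMean z' e * (1 - z' ^ 2 ^ e)) * (z ^ k * z ^ 2 ^ e)) := by
    rw [hk, h1, mul_neg, mul_neg, mul_assoc (dyadicMean z' e), ← mul_assoc (z ^ k), h2.eq]
    simp only [mul_assoc]
  rw [h3, norm_neg]
  exact norm_mul_le_right (norm_mul_le_one (norm_pow_le_one hz _) (norm_pow_le_one hz _))

variable {G : Type*} [Group G] {ρ : G →* (E →L[ℝ] E)}

lemma HeisenbergTriple.norm_le (hρ : ∀ g, ‖ρ g‖ ≤ 1) {x z y : G} (h : HeisenbergTriple x z y)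
    {L : ℝ} (hL0 : 1 < L) (hL : L ≤ 20 / 19) (hround : IsRound E L)
    {a b e n : ℕ} (hn : 15 ≤ n) (ha : 5 * n ≤ a) (hb : 5 * n ≤ b) (he : 5 * n ≤ e)
    (hab : e + 3 * n ≤ a + b) :
    ‖dyadicMean (ρ x) a * dyadicMean (ρ y) b * (dyadicMean (ρ z) e * (1 - ρ z ^ 2 ^ e))‖ ≤
      2 * L⁻¹ ^ n := by
  rcases h.rel with h1 | h1
  · rw [mul_assoc, ← mul_assoc (dyadicMean (ρ y) b)]
    refine heisenberg_decay (hρ x) (hρ y) (hρ z) ?_ ?_ ?_ hL0 hL hround hn ha hb he hab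
    · rw [← map_mul, h1, map_mul, map_mul]
    · exact h.comm_left.map ρ
    · exact h.comm_right.map ρ
  · refine (norm_mul_dyadicMean_inv_le (z' := ρ z⁻¹) (hρ z) ?_ ?_ _ _).trans ?_
    · rw [← map_mul, mul_inv_cancel, map_one]
    · rw [← map_mul, inv_mul_cancel, map_one]
    rw [mul_assoc, ← mul_assoc (dyadicMean (ρ y) b)]
    refine heisenberg_decay (hρ x) (hρ y) (hρ _) ?_ ?_ ?_ hL0 hL hround hn ha hb he hab
    · rw [← map_mul, ← map_mul, ← map_mul, mul_assoc, h1]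
      congr 1
      group
    · exact h.comm_left.inv_left.map ρ
    · exact h.comm_right.inv_left.map ρ

/-- The first move: all scales between `c` and `c'` remain `3 * n` below `a + b`, so each term of
the telescoping sum decays. -/
lemma HeisenbergTriple.norm_change_le (hρ : ∀ g, ‖ρ g‖ ≤ 1) {x z y : G}
    (h : HeisenbergTriple x z y) {L : ℝ} (hL0 : 1 < L) (hL : L ≤ 20 / 19) (hround : IsRound E L)
    {a b c c' n : ℕ} (hn : 15 ≤ n) (ha : 5 * n ≤ a) (hb : 5 * n ≤ b) (hc : 5 * n ≤ c)
    (hc' : 5 * n ≤ c') (hab : c + 3 * n ≤ a + b) (hab' : c' + 3 * n ≤ a + b) :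
    ‖dyadicMean (ρ x) a * dyadicMean (ρ z) c * dyadicMean (ρ y) b -
      dyadicMean (ρ x) a * dyadicMean (ρ z) c' * dyadicMean (ρ y) b‖ ≤
      (c + c') * (2 * L⁻¹ ^ n) := by
  wlog hcc : c ≤ c' generalizing c c'
  · rw [norm_sub_rev, add_comm]
    exact this hc' hc hab' hab (by omega)
  obtain ⟨k, rfl⟩ := Nat.exists_eq_add_of_le hcc
  have hLi : 0 < L⁻¹ := by positivity
  have hcomm : ∀ m, Commute (dyadicMean (ρ z) m) (dyadicMean (ρ y) b) := fun m =>
    (h.comm_right.map ρ).dyadicMean_dyadicMean m b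
  rw [mul_assoc, mul_assoc, (hcomm _).eq, (hcomm _).eq, ← mul_assoc, ← mul_assoc, ← mul_sub]
  refine (norm_mul_dyadicMean_sub_le (η := 2 * L⁻¹ ^ n) c k fun j hj hj' => ?_).trans ?_
  · exact h.norm_le hρ hL0 hL hround hn ha hb (by omega) (by omega)
  · gcongr
    push_cast
    have : (0 : ℝ) ≤ c := Nat.cast_nonneg c
    linarith

lemma norm_dyadicMean_mul_one_sub_pow_le' {z : E →L[ℝ] E} (hz : ‖z‖ ≤ 1) (m c : ℕ) :
    ‖dyadicMean z c * (1 - z ^ 2 ^ m)‖ ≤ 2 * (2 ^ m / 2 ^ c) := by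
  rcases le_total m c with h | h
  · obtain ⟨k, rfl⟩ := Nat.exists_eq_add_of_le h
    refine (norm_dyadicMean_mul_one_sub_pow_le hz m k).trans (le_of_eq ?_)
    rw [pow_add]
    field_simp
    rw [← mul_pow]; norm_num
  · refine ((norm_mul_le_left (norm_dyadicMean_le hz c)).trans (norm_one_sub_pow_le hz _)).trans ?_
    have : (1 : ℝ) ≤ 2 ^ m / 2 ^ c := by
      rw [one_le_div (by positivity)]
      exact pow_le_pow_right₀ (by norm_num) h
    linarith

/-- The second move: exchanging `x ^ i` and `y ^ j` creates `z ^ (i * j)` with `i * j < 2 ^ (a +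
b)`, which a mean of `z` over `2 ^ c` powers absorbs when `c` is larger than `a + b`. Convexity
plays no role. -/
lemma norm_swap_le_of_twist {x y z : E →L[ℝ] E} (hx : ‖x‖ ≤ 1) (hy : ‖y‖ ≤ 1) (hz : ‖z‖ ≤ 1)
    (h : y * x = z * x * y) (hzx : Commute z x) (hzy : Commute z y) (a b c : ℕ) :
    ‖dyadicMean y b * (dyadicMean x a * dyadicMean z c) -
      dyadicMean x a * (dyadicMean y b * dyadicMean z c)‖ ≤ 2 * (2 ^ (a + b) / 2 ^ c) := by
  induction b with
  | zero =>
    simp only [dyadicMean, one_mul, sub_self, norm_zero]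
    positivity
  | succ b ih =>
    set t := y ^ 2 ^ b with ht
    set X := dyadicMean x a
    set Y := dyadicMean y b
    set Z := dyadicMean z c
    have htn : ‖t‖ ≤ 1 := norm_pow_le_one hy _
    have hid : dyadicMean y (b + 1) * (X * Z) - X * (dyadicMean y (b + 1) * Z) =
        (1 / 2 : ℝ) • ((1 + t) * (Y * (X * Z) - X * (Y * Z))) +
          (1 / 2 : ℝ) • ((t * X - X * t) * (Y * Z)) := by
      rw [dyadicMean, ← smul_add, smul_mul_assoc, smul_mul_assoc, mul_smul_comm, ← smul_sub]
      congr 1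
      noncomm_ring
    have hcomm : ‖(t * X - X * t) * (Y * Z)‖ ≤ 2 ^ (a + b) / 2 ^ c := by
      refine ContinuousLinearMap.opNorm_le_bound _ (by positivity) fun v => ?_
      have h1 : t * X - X * t = (dyadicMean (z ^ 2 ^ b * x) a - X) * t := by
        rw [mul_dyadicMean_of_twist (twist_pow_left h hzy _), sub_mul]
      rw [h1, mul_assoc, mul_apply_eq_comp]
      refine (norm_dyadicMean_twist_sub_le hx (norm_pow_le_one hz _) (hzx.pow_left _) _ _).trans ?_
      have h2 : ∀ i ∈ Finset.range a, 1 / 2 * ‖(dyadicMean x i * (1 - (z ^ 2 ^ b) ^ 2 ^ i) :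
          E →L[ℝ] E) ((t * (Y * Z)) v)‖ ≤ 2 ^ i * (2 ^ b / 2 ^ c * ‖v‖) := by
        intro i _
        have hcY : Commute (1 - z ^ 2 ^ (b + i)) (t * Y) :=
          (Commute.one_left _).sub_left ((hzy.pow_pow _ _).mul_right
            ((hzy.dyadicMean_right b).pow_left _))
        have hcZ : Commute (1 - z ^ 2 ^ (b + i)) Z :=
          (Commute.one_left _).sub_left (((Commute.refl z).dyadicMean_right c).pow_left _)
        have h3 : dyadicMean x i * (1 - (z ^ 2 ^ b) ^ 2 ^ i) * (t * (Y * Z)) =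
            dyadicMean x i * (t * Y) * (Z * (1 - z ^ 2 ^ (b + i))) := by
          rw [← pow_mul, ← pow_add, mul_assoc, ← mul_assoc t, ← mul_assoc _ (t * Y), hcY.eq,
            mul_assoc (t * Y), hcZ.eq, ← mul_assoc]
        rw [← mul_apply_eq_comp, h3]
        have h4 : ‖dyadicMean x i * (t * Y) * (Z * (1 - z ^ 2 ^ (b + i)))‖ ≤
            2 * (2 ^ (b + i) / 2 ^ c) :=
          (norm_mul_le_left (norm_mul_le_one (norm_dyadicMean_le hx i)
            (norm_mul_le_one htn (norm_dyadicMean_le hy b)))).trans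
            (norm_dyadicMean_mul_one_sub_pow_le' hz _ _)
        have h5 := (dyadicMean x i * (t * Y) * (Z * (1 - z ^ 2 ^ (b + i)))).le_of_opNorm_le h4 v
        calc _ ≤ 1 / 2 * (2 * (2 ^ (b + i) / 2 ^ c) * ‖v‖) := by gcongr
          _ = _ := by rw [pow_add]; ring
      refine (Finset.sum_le_sum h2).trans ?_
      rw [← Finset.sum_mul, geom_sum_eq (by norm_num), pow_add]
      have h3 : 0 ≤ (2 : ℝ) ^ b / 2 ^ c * ‖v‖ := by positivity
      calc _ ≤ (2 : ℝ) ^ a * (2 ^ b / 2 ^ c * ‖v‖) := by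
            gcongr; norm_num
        _ = _ := by ring
    rw [hid]
    refine (norm_add_le _ _).trans ?_
    rw [norm_smul, norm_smul, Real.norm_of_nonneg (by norm_num)]
    have h1 : ‖1 + t‖ ≤ 2 := (norm_add_le _ _).trans (by
      linarith [ContinuousLinearMap.norm_one_le (E := E)])
    have h2 := (norm_mul_le (1 + t) (Y * (X * Z) - X * (Y * Z))).trans
      (mul_le_mul h1 ih (norm_nonneg _) zero_le_two)
    have h3 : (2 : ℝ) ^ (a + (b + 1)) / 2 ^ c = 2 * (2 ^ (a + b) / 2 ^ c) := by
      rw [← add_assoc, pow_succ]; ring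
    rw [h3]
    have h4 : (0 : ℝ) ≤ 2 ^ (a + b) / 2 ^ c := by positivity
    linarith

lemma HeisenbergTriple.norm_swap_le (hρ : ∀ g, ‖ρ g‖ ≤ 1) {x z y : G}
    (h : HeisenbergTriple x z y) (a b c : ℕ) :
    ‖dyadicMean (ρ x) a * dyadicMean (ρ z) c * dyadicMean (ρ y) b -
      dyadicMean (ρ y) b * dyadicMean (ρ z) c * dyadicMean (ρ x) a‖ ≤
      2 * (2 ^ (a + b) / 2 ^ c) := by
  have hx := ((h.comm_left.map ρ).dyadicMean_dyadicMean c a).eq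
  have hy := ((h.comm_right.map ρ).dyadicMean_dyadicMean c b).eq
  rw [mul_assoc, hy, mul_assoc, hx]
  rcases h.rel with h1 | h1
  · rw [norm_sub_rev]
    refine norm_swap_le_of_twist (hρ x) (hρ y) (hρ z) ?_ (h.comm_left.map ρ)
      (h.comm_right.map ρ) a b c
    rw [← map_mul, h1, map_mul, map_mul]
  · rw [add_comm]
    refine norm_swap_le_of_twist (hρ y) (hρ x) (hρ z) ?_ (h.comm_right.map ρ)
      (h.comm_left.map ρ) b a c
    rw [← map_mul, h1, map_mul, map_mul]

end Representation

/-! ### Six-letter words along the A₂ hexagon -/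

section Hexagon

variable {E : Type*} [NormedAddCommGroup E] [NormedSpace ℝ E]
variable {G : Type*} [Group G]

/-- Six group elements, cyclically ordered like the roots of `A₂`. -/
def IsHexagon (x : ZMod 6 → G) : Prop :=
  ∀ i, HeisenbergTriple (x i) (x (i + 1)) (x (i + 2))

/-- The reflection of a hexagon that exchanges the vertices `0` and `2`. -/
def reflectHexagon {α : Type*} (x : ZMod 6 → α) : ZMod 6 → α := fun i => x (2 - i)

lemma IsHexagon.reflect {x : ZMod 6 → G} (h : IsHexagon x) : IsHexagon (reflectHexagon x) := by
  intro i
  have := (h (2 - (i + 2))).symm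
  simp only [reflectHexagon]
  convert this using 2 <;> ring

lemma reflectHexagon_reflectHexagon {α : Type*} (x : ZMod 6 → α) :
    reflectHexagon (reflectHexagon x) = x := by
  funext i; simp [reflectHexagon]

/-- The product of the dyadic means along a hexagon with the given scales. -/
noncomputable def hexagonWord (ρ : G →* (E →L[ℝ] E)) (x : ZMod 6 → G)
    (a₀ a₁ a₂ a₃ a₄ a₅ : ℕ) : E →L[ℝ] E :=
  (dyadicMean (ρ (x 0)) a₀ * dyadicMean (ρ (x 1)) a₁ * dyadicMean (ρ (x 2)) a₂) *
    (dyadicMean (ρ (x 3)) a₃ * dyadicMean (ρ (x 4)) a₄ * dyadicMean (ρ (x 5)) a₅)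

lemma norm_mul_sub_mul_le {P P' Q Q' : E →L[ℝ] E} (hP : ‖P'‖ ≤ 1) (hQ : ‖Q‖ ≤ 1) :
    ‖P * Q - P' * Q'‖ ≤ ‖P - P'‖ + ‖Q - Q'‖ := by
  have : P * Q - P' * Q' = (P - P') * Q + P' * (Q - Q') := by noncomm_ring
  rw [this]
  exact (norm_add_le _ _).trans (add_le_add (norm_mul_le_right hQ) (norm_mul_le_left hP))

lemma norm_mul_triple_mul_le {A P Q B : E →L[ℝ] E} (hA : ‖A‖ ≤ 1) (hB : ‖B‖ ≤ 1) :
    ‖A * P * B - A * Q * B‖ ≤ ‖P - Q‖ := by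
  rw [← sub_mul, ← mul_sub]
  exact (norm_mul_le_right hB).trans (norm_mul_le_left hA)

variable {ρ : G →* (E →L[ℝ] E)}

/-- An inner letter changes scale through the Heisenberg triple formed with its two neighbours. The
end letters have one neighbour only; their scales change through the reflection. -/
lemma norm_hexagonWord_change₁_le (hρ : ∀ g, ‖ρ g‖ ≤ 1) {x : ZMod 6 → G} (hx : IsHexagon x)
    {L : ℝ} (hL0 : 1 < L) (hL : L ≤ 20 / 19) (hround : IsRound E L)
    {a₀ a₁ a₁' a₂ n : ℕ} (a₃ a₄ a₅ : ℕ) (hn : 15 ≤ n) (h0 : 5 * n ≤ a₀) (h2 : 5 * n ≤ a₂)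
    (h1 : 5 * n ≤ a₁) (h1' : 5 * n ≤ a₁') (h : a₁ + 3 * n ≤ a₀ + a₂)
    (h' : a₁' + 3 * n ≤ a₀ + a₂) :
    ‖hexagonWord ρ x a₀ a₁ a₂ a₃ a₄ a₅ - hexagonWord ρ x a₀ a₁' a₂ a₃ a₄ a₅‖ ≤
      (a₁ + a₁') * (2 * L⁻¹ ^ n) := by
  have hD : ∀ i n, ‖dyadicMean (ρ (x i)) n‖ ≤ 1 := fun i n => norm_dyadicMean_le (hρ _) n
  unfold hexagonWord
  rw [← sub_mul]
  refine (norm_mul_le_right (norm_mul_le_one (norm_mul_le_one (hD _ _) (hD _ _)) (hD _ _))).trans ?_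
  exact (hx 0).norm_change_le hρ hL0 hL hround hn h0 h2 h1 h1' h h'

lemma norm_hexagonWord_change₂_le (hρ : ∀ g, ‖ρ g‖ ≤ 1) {x : ZMod 6 → G} (hx : IsHexagon x)
    {L : ℝ} (hL0 : 1 < L) (hL : L ≤ 20 / 19) (hround : IsRound E L)
    {a₁ a₂ a₂' a₃ n : ℕ} (a₀ a₄ a₅ : ℕ) (hn : 15 ≤ n) (h0 : 5 * n ≤ a₁) (h2 : 5 * n ≤ a₃)
    (h1 : 5 * n ≤ a₂) (h1' : 5 * n ≤ a₂') (h : a₂ + 3 * n ≤ a₁ + a₃)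
    (h' : a₂' + 3 * n ≤ a₁ + a₃) :
    ‖hexagonWord ρ x a₀ a₁ a₂ a₃ a₄ a₅ - hexagonWord ρ x a₀ a₁ a₂' a₃ a₄ a₅‖ ≤
      (a₂ + a₂') * (2 * L⁻¹ ^ n) := by
  have hD : ∀ i n, ‖dyadicMean (ρ (x i)) n‖ ≤ 1 := fun i n => norm_dyadicMean_le (hρ _) n
  have key := (hx 1).norm_change_le hρ hL0 hL hround hn h0 h2 h1 h1' h h'
  refine le_trans (le_trans (le_of_eq ?_) (norm_mul_triple_mul_le (hD 0 a₀)
    (norm_mul_le_one (hD 4 a₄) (hD 5 a₅)))) key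
  simp only [hexagonWord, mul_assoc]
  rfl

lemma norm_hexagonWord_change₃_le (hρ : ∀ g, ‖ρ g‖ ≤ 1) {x : ZMod 6 → G} (hx : IsHexagon x)
    {L : ℝ} (hL0 : 1 < L) (hL : L ≤ 20 / 19) (hround : IsRound E L)
    {a₂ a₃ a₃' a₄ n : ℕ} (a₀ a₁ a₅ : ℕ) (hn : 15 ≤ n) (h0 : 5 * n ≤ a₂) (h2 : 5 * n ≤ a₄)
    (h1 : 5 * n ≤ a₃) (h1' : 5 * n ≤ a₃') (h : a₃ + 3 * n ≤ a₂ + a₄)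
    (h' : a₃' + 3 * n ≤ a₂ + a₄) :
    ‖hexagonWord ρ x a₀ a₁ a₂ a₃ a₄ a₅ - hexagonWord ρ x a₀ a₁ a₂ a₃' a₄ a₅‖ ≤
      (a₃ + a₃') * (2 * L⁻¹ ^ n) := by
  have hD : ∀ i n, ‖dyadicMean (ρ (x i)) n‖ ≤ 1 := fun i n => norm_dyadicMean_le (hρ _) n
  have key := (hx 2).norm_change_le hρ hL0 hL hround hn h0 h2 h1 h1' h h'
  refine le_trans (le_trans (le_of_eq ?_) (norm_mul_triple_mul_le
    (norm_mul_le_one (hD 0 a₀) (hD 1 a₁)) (hD 5 a₅))) key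
  simp only [hexagonWord, mul_assoc]
  rfl

lemma norm_hexagonWord_change₄_le (hρ : ∀ g, ‖ρ g‖ ≤ 1) {x : ZMod 6 → G} (hx : IsHexagon x)
    {L : ℝ} (hL0 : 1 < L) (hL : L ≤ 20 / 19) (hround : IsRound E L)
    {a₃ a₄ a₄' a₅ n : ℕ} (a₀ a₁ a₂ : ℕ) (hn : 15 ≤ n) (h0 : 5 * n ≤ a₃) (h2 : 5 * n ≤ a₅)
    (h1 : 5 * n ≤ a₄) (h1' : 5 * n ≤ a₄') (h : a₄ + 3 * n ≤ a₃ + a₅)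
    (h' : a₄' + 3 * n ≤ a₃ + a₅) :
    ‖hexagonWord ρ x a₀ a₁ a₂ a₃ a₄ a₅ - hexagonWord ρ x a₀ a₁ a₂ a₃ a₄' a₅‖ ≤
      (a₄ + a₄') * (2 * L⁻¹ ^ n) := by
  have hD : ∀ i n, ‖dyadicMean (ρ (x i)) n‖ ≤ 1 := fun i n => norm_dyadicMean_le (hρ _) n
  unfold hexagonWord
  rw [← mul_sub]
  refine (norm_mul_le_left (norm_mul_le_one (norm_mul_le_one (hD _ _) (hD _ _)) (hD _ _))).trans ?_
  exact (hx 3).norm_change_le hρ hL0 hL hround hn h0 h2 h1 h1' h h'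

/-- The map `i ↦ 2 - i` exchanges 0 with 2 and 3 with 5 and fixes 1 and 4, so reversing both halves
of the word is a reflection of the hexagon. -/
lemma norm_hexagonWord_sub_reflect_le (hρ : ∀ g, ‖ρ g‖ ≤ 1) {x : ZMod 6 → G} (hx : IsHexagon x)
    (a₀ a₁ a₂ a₃ a₄ a₅ : ℕ) :
    ‖hexagonWord ρ x a₀ a₁ a₂ a₃ a₄ a₅ -
      hexagonWord ρ (reflectHexagon x) a₂ a₁ a₀ a₅ a₄ a₃‖ ≤
      2 * (2 ^ (a₀ + a₂) / 2 ^ a₁) + 2 * (2 ^ (a₃ + a₅) / 2 ^ a₄) := by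
  have hD : ∀ i n, ‖dyadicMean (ρ (x i)) n‖ ≤ 1 := fun i n => norm_dyadicMean_le (hρ _) n
  have h1 := (hx 0).norm_swap_le hρ a₀ a₂ a₁
  have h2 := (hx 3).norm_swap_le hρ a₃ a₅ a₄
  refine (norm_mul_sub_mul_le ?_ ?_).trans (add_le_add h1 h2)
  all_goals exact norm_mul_le_one (norm_mul_le_one (norm_dyadicMean_le (hρ _) _)
    (norm_dyadicMean_le (hρ _) _)) (norm_dyadicMean_le (hρ _) _)

/-- The words with scales `(20 n, 60 n, 20 (n - 1), 20 (n - 1), 60 n, 20 n)`, shifted by one. -/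
noncomputable def hexagonMean (ρ : G →* (E →L[ℝ] E)) (x : ZMod 6 → G) (n : ℕ) : E →L[ℝ] E :=
  hexagonWord ρ (reflectHexagon^[n] x) (20 * n) (60 * n) (20 * (n - 1)) (20 * (n - 1))
    (60 * n) (20 * n)

lemma IsHexagon.iterate {x : ZMod 6 → G} (h : IsHexagon x) (n : ℕ) :
    IsHexagon (reflectHexagon^[n] x) := by
  induction n with
  | zero => exact h
  | succ n ih => rw [Function.iterate_succ_apply']; exact ih.reflect

lemma norm_sub_le_of_chain {E : Type*} [SeminormedAddCommGroup E]
    {A₀ A₁ A₂ A₃ A₄ A₅ A₆ A₇ : E} {c₁ c₂ c₃ c₄ c₅ c₆ c₇ : ℝ}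
    (h1 : ‖A₀ - A₁‖ ≤ c₁) (h2 : ‖A₁ - A₂‖ ≤ c₂) (h3 : ‖A₂ - A₃‖ ≤ c₃) (h4 : ‖A₃ - A₄‖ ≤ c₄)
    (h5 : ‖A₄ - A₅‖ ≤ c₅) (h6 : ‖A₅ - A₆‖ ≤ c₆) (h7 : ‖A₆ - A₇‖ ≤ c₇) :
    ‖A₀ - A₇‖ ≤ c₁ + c₂ + c₃ + c₄ + c₅ + c₆ + c₇ := by
  have : A₀ - A₇ = (A₀ - A₁) + (A₁ - A₂) + (A₂ - A₃) + (A₃ - A₄) + (A₄ - A₅) + (A₅ - A₆) +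
    (A₆ - A₇) := by abel
  rw [this]
  exact norm_add_le_of_le (norm_add_le_of_le (norm_add_le_of_le (norm_add_le_of_le
    (norm_add_le_of_le (norm_add_le_of_le h1 h2) h3) h4) h5) h6) h7

lemma two_pow_div_two_pow_le {r : ℝ} (hr : 1 / 2 ≤ r) {m k n : ℕ} (h : m + n ≤ k) :
    (2 : ℝ) ^ m / 2 ^ k ≤ r ^ n := by
  refine le_trans ?_ (pow_le_pow_left₀ (by norm_num) hr n)
  rw [div_le_iff₀ (by positivity), one_div, inv_pow, inv_mul_eq_div,
    le_div_iff₀ (by positivity), ← pow_add]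
  exact pow_le_pow_right₀ (by norm_num) h

/-- The two middle scales are raised from `c` to `b` to make room for `b → b'`, then lowered to
`a'`. Now `a + a' = 40 * n + 20` is well below `b' = 60 * n + 60`, so the reflection is cheap; it
carries the longer means `a'` to the ends. -/
lemma norm_hexagonWord_step_le (hρ : ∀ g, ‖ρ g‖ ≤ 1) {y : ZMod 6 → G} (hy : IsHexagon y)
    {L : ℝ} (hL0 : 1 < L) (hL : L ≤ 20 / 19) (hround : IsRound E L) {n a b c a' b' : ℕ}
    (hn : 15 ≤ n) (ha : a = 20 * n) (hb : b = 60 * n) (hc : c = 20 * (n - 1))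
    (ha' : a' = 20 * (n + 1)) (hb' : b' = 60 * (n + 1)) :
    ‖hexagonWord ρ y a b c c b a - hexagonWord ρ (reflectHexagon y) a' b' a a b' a'‖ ≤
      2000 * (n + 1) * L⁻¹ ^ n := by
  have s1 : ‖hexagonWord ρ y a b c c b a - hexagonWord ρ y a b b c b a‖ ≤ _ :=
    norm_hexagonWord_change₂_le hρ hy hL0 hL hround (n := n) a b a hn
      (by omega) (by omega) (by omega) (by omega) (by omega) (by omega)
  have s2 : ‖hexagonWord ρ y a b b c b a - hexagonWord ρ y a b b b b a‖ ≤ _ :=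
    norm_hexagonWord_change₃_le hρ hy hL0 hL hround (n := n) a b a hn
      (by omega) (by omega) (by omega) (by omega) (by omega) (by omega)
  have s3 : ‖hexagonWord ρ y a b b b b a - hexagonWord ρ y a b' b b b a‖ ≤ _ :=
    norm_hexagonWord_change₁_le hρ hy hL0 hL hround (n := n) b b a hn
      (by omega) (by omega) (by omega) (by omega) (by omega) (by omega)
  have s4 : ‖hexagonWord ρ y a b' b b b a - hexagonWord ρ y a b' b b b' a‖ ≤ _ :=
    norm_hexagonWord_change₄_le hρ hy hL0 hL hround (n := n) a b' b hn
      (by omega) (by omega) (by omega) (by omega) (by omega) (by omega)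
  have s5 : ‖hexagonWord ρ y a b' b b b' a - hexagonWord ρ y a b' a' b b' a‖ ≤ _ :=
    norm_hexagonWord_change₂_le hρ hy hL0 hL hround (n := n) a b' a hn
      (by omega) (by omega) (by omega) (by omega) (by omega) (by omega)
  have s6 : ‖hexagonWord ρ y a b' a' b b' a - hexagonWord ρ y a b' a' a' b' a‖ ≤ _ :=
    norm_hexagonWord_change₃_le hρ hy hL0 hL hround (n := n) a b' a hn
      (by omega) (by omega) (by omega) (by omega) (by omega) (by omega)
  have s7 : ‖hexagonWord ρ y a b' a' a' b' a -
      hexagonWord ρ (reflectHexagon y) a' b' a a b' a'‖ ≤ _ :=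
    norm_hexagonWord_sub_reflect_le hρ hy a b' a' a' b' a
  have hLi : 0 < L⁻¹ := by positivity
  have hLi' : 19 / 20 ≤ L⁻¹ := by
    rw [le_inv_comm₀ (by norm_num) (by linarith)]; norm_num; linarith
  have hpow : 0 < L⁻¹ ^ n := by positivity
  have t1 : (2 : ℝ) ^ (a + a') / 2 ^ b' ≤ L⁻¹ ^ n :=
    two_pow_div_two_pow_le (by linarith) (by omega)
  have t2 : (2 : ℝ) ^ (a' + a) / 2 ^ b' ≤ L⁻¹ ^ n :=
    two_pow_div_two_pow_le (by linarith) (by omega)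
  refine (norm_sub_le_of_chain s1 s2 s3 s4 s5 s6 s7).trans ?_
  have ea : (a : ℝ) = 20 * n := by rw [ha]; push_cast; ring
  have eb : (b : ℝ) = 60 * n := by rw [hb]; push_cast; ring
  have ec : (c : ℝ) ≤ 20 * n := by
    rw [← ea]; exact_mod_cast (show c ≤ a by omega)
  have ea' : (a' : ℝ) = 20 * (n + 1) := by rw [ha']; push_cast; ring
  have eb' : (b' : ℝ) = 60 * (n + 1) := by rw [hb']; push_cast; ring
  have hn0 : (0 : ℝ) ≤ n := Nat.cast_nonneg n
  have hcn : (c : ℝ) * L⁻¹ ^ n ≤ 20 * n * L⁻¹ ^ n := by gcongr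
  have hnn : (0 : ℝ) ≤ n * L⁻¹ ^ n := by positivity
  rw [ea, eb, ea', eb'] at *
  clear s1 s2 s3 s4 s5 s6 s7
  linarith

lemma norm_hexagonMean_sub_succ_le (hρ : ∀ g, ‖ρ g‖ ≤ 1) {x : ZMod 6 → G} (hx : IsHexagon x)
    {L : ℝ} (hL0 : 1 < L) (hL : L ≤ 20 / 19) (hround : IsRound E L) {n : ℕ} (hn : 15 ≤ n) :
    ‖hexagonMean ρ x n - hexagonMean ρ x (n + 1)‖ ≤ 2000 * (n + 1) * L⁻¹ ^ n := by
  unfold hexagonMean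
  rw [Function.iterate_succ_apply', Nat.add_sub_cancel]
  exact norm_hexagonWord_step_le hρ (hx.iterate n) hL0 hL hround hn rfl rfl rfl rfl rfl

end Hexagon

/-! ### Convergence of the words and relative property (T) -/

section HexagonConvergence

lemma norm_dyadicMean_apply_sub_le {E : Type*} [NormedAddCommGroup E] [NormedSpace ℝ E]
    {x : E →L[ℝ] E} (hx : ‖x‖ ≤ 1) (ξ : E) (n : ℕ) :
    ‖dyadicMean x n ξ - ξ‖ ≤ 2 ^ n * ‖x ξ - ξ‖ := by
  induction n with
  | zero => simp [dyadicMean]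
  | succ n ih =>
    have h1 : dyadicMean x (n + 1) ξ - ξ = (1 / 2 : ℝ) • (dyadicMean x n ξ - ξ) +
        (1 / 2 : ℝ) • ((x ^ 2 ^ n : E →L[ℝ] E) (dyadicMean x n ξ - ξ)) +
        (1 / 2 : ℝ) • ((x ^ 2 ^ n : E →L[ℝ] E) ξ - ξ) := by
      simp only [dyadicMean, smul_apply, mul_apply_eq_comp, add_apply, one_apply_eq_self, map_sub]
      module
    have h2 := norm_apply_le_of_norm_le_one (norm_pow_le_one hx (2 ^ n)) (dyadicMean x n ξ - ξ)
    have h3 := norm_pow_apply_sub_le hx ξ (2 ^ n)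
    rw [Nat.cast_pow, Nat.cast_ofNat] at h3
    rw [h1]
    refine norm_add₃_le.trans ?_
    rw [norm_smul, norm_smul, norm_smul, Real.norm_of_nonneg (by norm_num), pow_succ]
    generalize (x ^ 2 ^ n : E →L[ℝ] E) = y at *
    have h4 : 0 ≤ 2 ^ n * ‖x ξ - ξ‖ := by positivity
    linarith

lemma norm_mul_apply_sub_le {E : Type*} [NormedAddCommGroup E] [NormedSpace ℝ E]
    {A B : E →L[ℝ] E} (hA : ‖A‖ ≤ 1) {ξ : E} {a b : ℝ} (h : ‖A ξ - ξ‖ ≤ a) (h' : ‖B ξ - ξ‖ ≤ b) :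
    ‖(A * B) ξ - ξ‖ ≤ a + b := by
  have : (A * B) ξ - ξ = (A ξ - ξ) + A (B ξ - ξ) := by
    rw [mul_apply_eq_comp, map_sub]; abel
  rw [this]
  exact norm_add_le_of_le h ((norm_apply_le_of_norm_le_one hA _).trans h')

variable {E : Type*} [NormedAddCommGroup E] [NormedSpace ℝ E] {G : Type*} [Group G]
  {ρ : G →* (E →L[ℝ] E)}

lemma reflectHexagon_iterate_apply_mem {α : Type*} (x : ZMod 6 → α) (n : ℕ) (i : ZMod 6) :
    ∃ j, reflectHexagon^[n] x i = x j := by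
  induction n generalizing i with
  | zero => exact ⟨i, rfl⟩
  | succ n ih => rw [Function.iterate_succ_apply']; exact ih _

lemma norm_hexagonMean_apply_sub_le (hρ : ∀ g, ‖ρ g‖ ≤ 1) (x : ZMod 6 → G) {ξ : E} {D : ℝ}
    (hD : ∀ i, ‖ρ (x i) ξ - ξ‖ ≤ D) (n : ℕ) :
    ‖hexagonMean ρ x n ξ - ξ‖ ≤ 6 * 2 ^ (60 * n) * D := by
  have hn : ∀ g n, ‖dyadicMean (ρ g) n‖ ≤ 1 := fun g n => norm_dyadicMean_le (hρ g) n
  have key : ∀ i, ∀ m ≤ 60 * n, ‖dyadicMean (ρ (reflectHexagon^[n] x i)) m ξ - ξ‖ ≤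
      2 ^ (60 * n) * D := by
    intro i m hm
    obtain ⟨j, hj⟩ := reflectHexagon_iterate_apply_mem x n i
    rw [hj]
    refine (norm_dyadicMean_apply_sub_le (hρ _) ξ m).trans
      (mul_le_mul (pow_le_pow_right₀ (by norm_num) hm) (hD j) (norm_nonneg _) (by positivity))
  refine (norm_mul_apply_sub_le
    (norm_mul_le_one (norm_mul_le_one (hn _ _) (hn _ _)) (hn _ _))
    (norm_mul_apply_sub_le (norm_mul_le_one (hn _ _) (hn _ _))
      (norm_mul_apply_sub_le (hn _ _) (key 0 _ (by omega)) (key 1 _ (by omega)))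
      (key 2 _ (by omega)))
    (norm_mul_apply_sub_le (norm_mul_le_one (hn _ _) (hn _ _))
      (norm_mul_apply_sub_le (hn _ _) (key 3 _ (by omega)) (key 4 _ (by omega)))
      (key 5 _ (by omega)))).trans ?_
  linarith

lemma norm_hexagonMean_sub_le (hρ : ∀ g, ‖ρ g‖ ≤ 1) {x : ZMod 6 → G} (hx : IsHexagon x)
    {L : ℝ} (hL0 : 1 < L) (hL : L ≤ 20 / 19) (hround : IsRound E L) {n : ℕ} (hn : 15 ≤ n)
    (k : ℕ) : ‖hexagonMean ρ x n - hexagonMean ρ x (n + k)‖ ≤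
      ∑ j ∈ Finset.range k, 2000 * ((j + n : ℕ) + 1) * L⁻¹ ^ (j + n) := by
  induction k with
  | zero => simp
  | succ k ih =>
    rw [Finset.sum_range_succ]
    refine (norm_sub_le_norm_sub_add_norm_sub _ (hexagonMean ρ x (n + k)) _).trans
      (add_le_add ih ?_)
    have := norm_hexagonMean_sub_succ_le hρ hx hL0 hL hround (n := n + k) (by omega)
    rw [add_comm k n, ← add_assoc]
    convert this

lemma reflectHexagon_iterate_even {α : Type*} (x : ZMod 6 → α) (n : ℕ) :
    reflectHexagon^[2 * n] x = x := by
  induction n with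
  | zero => rfl
  | succ n ih =>
    rw [mul_add, mul_one, Function.iterate_succ_apply', Function.iterate_succ_apply',
      reflectHexagon_reflectHexagon, ih]

/-- After an even number of reflections the first letter is a mean of `ρ (x 0)` itself, so long that
it nearly annihilates `1 - ρ (x 0)`. -/
lemma norm_hexagonMean_even_apply_sub_le (hρ : ∀ g, ‖ρ g‖ ≤ 1) (x : ZMod 6 → G) (n k : ℕ)
    (ξ : E) : ‖(ρ (x 0) ^ k : E →L[ℝ] E) (hexagonMean ρ x (2 * n) ξ) -
      hexagonMean ρ x (2 * n) ξ‖ ≤ k * ((1 / 2) ^ n * 2 * ‖ξ‖) := by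
  refine (norm_pow_apply_sub_le (hρ _) _ k).trans ?_
  gcongr
  have hn : ∀ g n, ‖dyadicMean (ρ g) n‖ ≤ 1 := fun g n => norm_dyadicMean_le (hρ g) n
  set y := ρ (x 0) with hy
  obtain ⟨R, hR, h⟩ : ∃ R : E →L[ℝ] E, ‖R‖ ≤ 1 ∧
      hexagonMean ρ x (2 * n) = dyadicMean y (20 * (2 * n)) * R := by
    refine ⟨_, ?_, by
      rw [hexagonMean, reflectHexagon_iterate_even, hexagonWord]; simp only [mul_assoc]; rfl⟩
    exact norm_mul_le_one (hn _ _) (norm_mul_le_one (hn _ _) (norm_mul_le_one (hn _ _)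
      (norm_mul_le_one (hn _ _) (hn _ _))))
  have h1 : y (hexagonMean ρ x (2 * n) ξ) - hexagonMean ρ x (2 * n) ξ =
      -((dyadicMean y (20 * (2 * n)) * (1 - y)) * R) ξ := by
    have hc : Commute (1 - y) (dyadicMean y (20 * (2 * n))) :=
      (Commute.one_left _).sub_left ((Commute.refl y).dyadicMean_right _)
    rw [h, ← hc.eq]
    simp [mul_apply_eq_comp, sub_apply]
  rw [h1, norm_neg]
  have h2 := norm_dyadicMean_mul_one_sub_pow_le (hρ (x 0)) 0 (20 * (2 * n))
  rw [zero_add, pow_zero, pow_one, ← hy] at h2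
  have h3 : (1 / 2 : ℝ) ^ (20 * (2 * n)) ≤ (1 / 2) ^ n :=
    pow_le_pow_of_le_one (by norm_num) (by norm_num) (by omega)
  exact ContinuousLinearMap.le_of_opNorm_le _ ((norm_mul_le_right hR).trans (h2.trans
    (mul_le_mul_of_nonneg_right h3 zero_le_two))) ξ

/-- Relative property (T) of a vertex of a hexagon, for round normed spaces. -/
theorem exists_forall_norm_hexagon_pow_sub_le {L : ℝ} (hL0 : 1 < L) (hL : L ≤ 20 / 19) {ε : ℝ}
    (hε : 0 < ε) : ∃ C : ℝ, 0 ≤ C ∧ ∀ (E : Type u) [NormedAddCommGroup E] [NormedSpace ℝ E]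
      (G : Type v) [Group G] (ρ : G →* (E →L[ℝ] E)) (x : ZMod 6 → G) (ξ : E) (D : ℝ),
      IsRound E L → (∀ g, ‖ρ g‖ ≤ 1) → IsHexagon x → (∀ i, ‖ρ (x i) ξ - ξ‖ ≤ D) →
      ∀ k : ℕ, ‖ρ (x 0 ^ k) ξ - ξ‖ ≤ C * D + ε * ‖ξ‖ := by
  set u : ℕ → ℝ := fun j => 2000 * ((j : ℝ) + 1) * L⁻¹ ^ j with hu
  have hLi : 0 < L⁻¹ := by positivity
  have hu0 : ∀ j, 0 ≤ u j := fun j => by positivity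
  have hsum : Summable u := by
    have hLn : ‖L⁻¹‖ < 1 := by
      rw [Real.norm_of_nonneg hLi.le]; exact inv_lt_one_of_one_lt₀ hL0
    have h1 := (summable_pow_mul_geometric_of_norm_lt_one 1 hLn).add
      (summable_geometric_of_norm_lt_one hLn)
    refine (h1.mul_left 2000).congr fun j => ?_
    simp only [hu, pow_one]; ring
  have htail := tendsto_sum_nat_add u
  obtain ⟨N, hN⟩ := (htail.eventually (gt_mem_nhds (show (0 : ℝ) < ε / 4 by positivity))).exists_forall_of_atTop
  set m := 2 * (N + 15) with hm
  refine ⟨2 * (6 * 2 ^ (60 * m)), by positivity, ?_⟩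
  intro E _ _ G _ ρ x ξ D hround hρ hx hD k
  have hCauchy : ∀ k, ‖hexagonMean ρ x m - hexagonMean ρ x (m + k)‖ ≤ ε / 4 := by
    intro k
    refine (norm_hexagonMean_sub_le hρ hx hL0 hL hround (by omega) k).trans ?_
    refine le_trans ?_ (hN m (by omega)).le
    exact ((summable_nat_add_iff m).2 hsum).sum_le_tsum _ (fun j _ => hu0 _)
  -- `M` may depend on `k`, since passing from word `m` to word `m + 2 * M` costs `ε / 4` for any
  -- `M`. The constant depends on `m` alone.
  obtain ⟨M, hM⟩ : ∃ M : ℕ, (k : ℝ) * ((1 / 2) ^ M * 2 * ‖ξ‖) ≤ ε / 4 * ‖ξ‖ := by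
    obtain ⟨M, hM⟩ := exists_pow_lt_of_lt_one (show (0 : ℝ) < ε / 4 / (2 * k + 1) by positivity)
      (show (1 / 2 : ℝ) < 1 by norm_num)
    refine ⟨M, ?_⟩
    rw [lt_div_iff₀ (by positivity)] at hM
    have h1 : (0 : ℝ) < (1 / 2) ^ M := by positivity
    have h2 : (k : ℝ) * ((1 / 2) ^ M * 2) ≤ ε / 4 := by linarith
    calc (k : ℝ) * ((1 / 2) ^ M * 2 * ‖ξ‖) = k * ((1 / 2) ^ M * 2) * ‖ξ‖ := by ring
      _ ≤ _ := by gcongr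
  have hM' : (k : ℝ) * ((1 / 2) ^ (N + 15 + M) * 2 * ‖ξ‖) ≤ ε / 4 * ‖ξ‖ := by
    refine le_trans ?_ hM
    have : (1 / 2 : ℝ) ^ (N + 15 + M) ≤ (1 / 2) ^ M :=
      pow_le_pow_of_le_one (by norm_num) (by norm_num) (by omega)
    gcongr
  set A := hexagonMean ρ x m
  set B := hexagonMean ρ x (2 * (N + 15 + M)) with hB
  have hAB : ‖A ξ - B ξ‖ ≤ ε / 4 * ‖ξ‖ := by
    have h1 := hCauchy (2 * M)
    rw [hm, ← mul_add] at h1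
    exact (A - B).le_of_opNorm_le h1 ξ
  have hA := norm_hexagonMean_apply_sub_le hρ x hD m
  have hBk := (norm_hexagonMean_even_apply_sub_le hρ x (N + 15 + M) k ξ).trans hM'
  rw [map_pow]
  have hy : ‖ρ (x 0) ^ k‖ ≤ 1 := norm_pow_le_one (hρ _) k
  set y := ρ (x 0) ^ k
  have hid : y ξ - ξ = (-(y (A ξ - ξ)) + (A ξ - ξ)) + (y (A ξ - B ξ) + (y (B ξ) - B ξ)) -
      (A ξ - B ξ) := by
    simp only [map_sub]; abel
  have h1 := norm_apply_le_of_norm_le_one hy (A ξ - ξ)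
  have h2 := norm_apply_le_of_norm_le_one hy (A ξ - B ξ)
  rw [← norm_neg] at h1
  have h3 : ‖y ξ - ξ‖ ≤ (6 * 2 ^ (60 * m) * D + 6 * 2 ^ (60 * m) * D) +
      (ε / 4 * ‖ξ‖ + ε / 4 * ‖ξ‖) + ε / 4 * ‖ξ‖ := by
    rw [hid]
    exact norm_sub_le_of_le (norm_add_le_of_le (norm_add_le_of_le (h1.trans hA) hA)
      (norm_add_le_of_le (h2.trans hAB) hBk)) hAB
  have h4 : 0 ≤ ε * ‖ξ‖ := by positivity
  generalize (6 * 2 ^ (60 * m) : ℝ) = C at h3 ⊢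
  linarith

end HexagonConvergence

/-! ### Bounded elementary generation over finite rings -/

section BoundedElementaryGeneration

/-- Stable rank one, by the Chinese remainder theorem: with `t ≡ 1` modulo the maximal ideals
containing `a` and `t ≡ 0` modulo the others, `a + t * d` lies in none. -/
lemma exists_isUnit_add_mul_of_isCoprime {R : Type*} [CommRing R] [Finite R] {a d : R}
    (h : IsCoprime a d) : ∃ t, IsUnit (a + t * d) := by
  classical
  have : Finite (MaximalSpectrum R) :=
    Finite.of_injective MaximalSpectrum.asIdeal fun _ _ h => MaximalSpectrum.ext h
  obtain ⟨t, ht⟩ := Ideal.exists_forall_sub_mem_ideal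
    (I := fun m : MaximalSpectrum R => m.asIdeal)
    (fun m m' hne => Ideal.isCoprime_of_isMaximal fun h => hne (MaximalSpectrum.ext h))
    (fun m => if a ∈ m.asIdeal then 1 else 0)
  refine ⟨t, ?_⟩
  by_contra hu
  obtain ⟨I, hI, hmem⟩ := exists_max_ideal_of_mem_nonunits (mem_nonunits_iff.2 hu)
  have hIm := ht ⟨I, hI⟩
  simp only at hIm
  obtain ⟨x, y, hxy⟩ := h
  by_cases ha : a ∈ I
  · rw [if_pos ha] at hIm
    have hd : t * d ∈ I := (Ideal.add_mem_iff_right I ha).1 hmem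
    have hd' : d ∈ I := by
      have h1 := I.sub_mem hd (I.mul_mem_right d hIm)
      have h2 : t * d - (t - 1) * d = d := by ring
      rwa [h2] at h1
    exact hI.ne_top ((Ideal.eq_top_iff_one I).2
      (hxy ▸ I.add_mem (I.mul_mem_left x ha) (I.mul_mem_left y hd')))
  · rw [if_neg ha, sub_zero] at hIm
    exact ha ((Ideal.add_mem_iff_left I (I.mul_mem_right d hIm)).1 hmem)

open Matrix

variable {ι R : Type*} [DecidableEq ι] [Fintype ι] [CommRing R]

/-- `g` is a product of at most `k` transvections. -/
def IsTransvectionProduct (k : ℕ) (g : SpecialLinearGroup ι R) : Prop :=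
  ∃ l : List (SpecialLinearGroup ι R), l.length ≤ k ∧ l.prod = g ∧
    ∀ t ∈ l, ∃ (i j : ι) (hij : i ≠ j) (c : R), t = SpecialLinearGroup.transvection hij c

lemma IsTransvectionProduct.mul {k k' : ℕ} {g g' : SpecialLinearGroup ι R}
    (h : IsTransvectionProduct k g) (h' : IsTransvectionProduct k' g') :
    IsTransvectionProduct (k + k') (g * g') := by
  obtain ⟨l, hl, rfl, ht⟩ := h
  obtain ⟨l', hl', rfl, ht'⟩ := h'
  refine ⟨l ++ l', by rw [List.length_append]; omega, List.prod_append, fun t hm => ?_⟩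
  rcases List.mem_append.1 hm with hm | hm
  exacts [ht t hm, ht' t hm]

lemma isTransvectionProduct_one (k : ℕ) : IsTransvectionProduct k (1 : SpecialLinearGroup ι R) :=
  ⟨[], by simp, rfl, by simp⟩

lemma isTransvectionProduct_transvection {i j : ι} (hij : i ≠ j) (c : R) :
    IsTransvectionProduct 1 (SpecialLinearGroup.transvection hij c) :=
  ⟨[_], by simp, by simp, fun t ht => ⟨i, j, hij, c, List.mem_singleton.1 ht⟩⟩

/-- `M` is obtained from `M'` by multiplication with at most `k` transvections. -/
def TransvectionRel (k : ℕ) (M M' : SpecialLinearGroup ι R) : Prop :=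
  ∃ (a b : ℕ) (g h : SpecialLinearGroup ι R), a + b ≤ k ∧ IsTransvectionProduct a g ∧
    IsTransvectionProduct b h ∧ M = g * M' * h

lemma TransvectionRel.refl (M : SpecialLinearGroup ι R) (k : ℕ) : TransvectionRel k M M :=
  ⟨0, 0, 1, 1, by omega, isTransvectionProduct_one _, isTransvectionProduct_one _, by simp⟩

lemma TransvectionRel.trans {k k' : ℕ} {M M' M'' : SpecialLinearGroup ι R}
    (h : TransvectionRel k M M') (h' : TransvectionRel k' M' M'') :
    TransvectionRel (k + k') M M'' := by
  obtain ⟨a, b, g, h, hab, hg, hh, rfl⟩ := h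
  obtain ⟨a', b', g', h', hab', hg', hh', rfl⟩ := h'
  exact ⟨a + a', b' + b, g * g', h' * h, by omega, hg.mul hg', hh'.mul hh,
    by simp only [mul_assoc]⟩

lemma TransvectionRel.mono {k k' : ℕ} {M M' : SpecialLinearGroup ι R}
    (h : TransvectionRel k M M') (hk : k ≤ k') : TransvectionRel k' M M' := by
  obtain ⟨a, b, g, h, hab, hg, hh, rfl⟩ := h
  exact ⟨a, b, g, h, by omega, hg, hh, rfl⟩

lemma transvectionRel_mul_left (M : SpecialLinearGroup ι R) {i j : ι} (hij : i ≠ j) (c : R) :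
    TransvectionRel 1 M (SpecialLinearGroup.transvection hij c * M) := by
  refine ⟨1, 0, _, 1, le_rfl, isTransvectionProduct_transvection hij (-c),
    isTransvectionProduct_one _, ?_⟩
  rw [← SpecialLinearGroup.transvection_inv]; simp

lemma transvectionRel_mul_right (M : SpecialLinearGroup ι R) {i j : ι} (hij : i ≠ j) (c : R) :
    TransvectionRel 1 M (M * SpecialLinearGroup.transvection hij c) := by
  refine ⟨0, 1, 1, _, le_rfl, isTransvectionProduct_one _,
    isTransvectionProduct_transvection hij (-c), ?_⟩
  rw [← SpecialLinearGroup.transvection_inv]; simp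

lemma transvection_mul_coe_apply (M : SpecialLinearGroup ι R) {i j : ι} (hij : i ≠ j) (c : R)
    (a b : ι) : (SpecialLinearGroup.transvection hij c * M).1 a b =
      M.1 a b + if a = i then c * M.1 j b else 0 := by
  change (Matrix.transvection i j c * M.1) a b = _
  split_ifs with h
  · subst h; rw [transvection_mul_apply_same]
  · rw [transvection_mul_apply_of_ne _ _ _ _ h, add_zero]

lemma mul_transvection_coe_apply (M : SpecialLinearGroup ι R) {i j : ι} (hij : i ≠ j) (c : R)
    (a b : ι) : (M * SpecialLinearGroup.transvection hij c).1 a b =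
      M.1 a b + if b = j then c * M.1 a i else 0 := by
  change (M.1 * Matrix.transvection i j c) a b = _
  split_ifs with h
  · subst h; rw [mul_transvection_apply_same]
  · rw [mul_transvection_apply_of_ne _ _ _ _ h, add_zero]

/-- The rows and columns of `M` with index in `T` are those of the identity matrix. -/
def IsReducedOn (T : Finset ι) (M : SpecialLinearGroup ι R) : Prop :=
  ∀ j ∈ T, ∀ i, M.1 i j = (1 : Matrix ι ι R) i j ∧ M.1 j i = (1 : Matrix ι ι R) j i

lemma IsReducedOn.transvection_mul {T : Finset ι} {M : SpecialLinearGroup ι R}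
    (h : IsReducedOn T M) {a b : ι} (ha : a ∉ T) (hb : b ∉ T) (hab : a ≠ b) (c : R) :
    IsReducedOn T (SpecialLinearGroup.transvection hab c * M) := by
  intro j hj i
  have hja : j ≠ a := fun h => ha (h ▸ hj)
  have hjb : b ≠ j := fun h => hb (h ▸ hj)
  rw [transvection_mul_coe_apply, transvection_mul_coe_apply, if_neg hja, add_zero,
    (h j hj b).1, one_apply_ne hjb, mul_zero, ite_self, add_zero]
  exact h j hj i

lemma IsReducedOn.mul_transvection {T : Finset ι} {M : SpecialLinearGroup ι R}
    (h : IsReducedOn T M) {a b : ι} (ha : a ∉ T) (hb : b ∉ T) (hab : a ≠ b) (c : R) :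
    IsReducedOn T (M * SpecialLinearGroup.transvection hab c) := by
  intro j hj i
  have hja : j ≠ a := fun h => ha (h ▸ hj)
  have hjb : j ≠ b := fun h => hb (h ▸ hj)
  rw [mul_transvection_coe_apply, mul_transvection_coe_apply, if_neg hjb, add_zero,
    (h j hj a).2, one_apply_ne hja, mul_zero, ite_self, add_zero]
  exact h j hj i

lemma exists_transvectionRel_add_sum {T : Finset ι} {p : ι} (hp : p ∉ T) (t : ι → R)
    {M : SpecialLinearGroup ι R} (hM : IsReducedOn T M) (I : Finset ι)
    (hI : ∀ i ∈ I, i ∉ T ∧ i ≠ p) :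
    ∃ M', TransvectionRel I.card M M' ∧ IsReducedOn T M' ∧
      M'.1 p p = M.1 p p + ∑ i ∈ I, t i * M.1 i p ∧ ∀ i, i ≠ p → M'.1 i p = M.1 i p := by
  induction I using Finset.induction_on with
  | empty => exact ⟨M, .refl _ _, hM, by simp, fun _ _ => rfl⟩
  | insert a I ha ih =>
    obtain ⟨M', h1, h2, h3, h4⟩ := ih fun i hi => hI i (Finset.mem_insert_of_mem hi)
    obtain ⟨haT, hap⟩ := hI a (Finset.mem_insert_self _ _)
    refine ⟨_, ?_, h2.transvection_mul hp haT hap.symm (t a), ?_, fun i hi => ?_⟩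
    · rw [Finset.card_insert_of_notMem ha]
      exact h1.trans (transvectionRel_mul_left M' hap.symm (t a))
    · rw [transvection_mul_coe_apply, if_pos rfl, h3, h4 a hap, Finset.sum_insert ha]; ring
    · rw [transvection_mul_coe_apply, if_neg hi, add_zero, h4 i hi]

lemma exists_transvectionRel_clear_column {T : Finset ι} {p : ι} (hp : p ∉ T)
    {M : SpecialLinearGroup ι R} (hM : IsReducedOn T M) (hpp : M.1 p p = 1) (I : Finset ι)
    (hI : ∀ i ∈ I, i ∉ T ∧ i ≠ p) :
    ∃ M', TransvectionRel I.card M M' ∧ IsReducedOn T M' ∧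
      ∀ i, M'.1 i p = if i ∈ I then 0 else M.1 i p := by
  induction I using Finset.induction_on with
  | empty => exact ⟨M, .refl _ _, hM, by simp⟩
  | insert a I ha ih =>
    obtain ⟨M', h1, h2, h3⟩ := ih fun i hi => hI i (Finset.mem_insert_of_mem hi)
    obtain ⟨haT, hap⟩ := hI a (Finset.mem_insert_self _ _)
    have hpI : p ∉ I := fun h => (hI p (Finset.mem_insert_of_mem h)).2 rfl
    refine ⟨_, ?_, h2.transvection_mul haT hp hap (-M.1 a p), fun i => ?_⟩
    · rw [Finset.card_insert_of_notMem ha]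
      exact h1.trans (transvectionRel_mul_left M' hap _)
    · rw [transvection_mul_coe_apply, h3, h3, if_neg hpI, hpp]
      by_cases hia : i = a
      · subst hia; simp [ha]
      · simp [hia]

lemma exists_transvectionRel_clear_row {T : Finset ι} {p : ι} (hp : p ∉ T)
    {M : SpecialLinearGroup ι R} (hM : IsReducedOn T M) (hpp : M.1 p p = 1) (I : Finset ι)
    (hI : ∀ i ∈ I, i ∉ T ∧ i ≠ p) :
    ∃ M', TransvectionRel I.card M M' ∧ IsReducedOn T M' ∧ (∀ i, M'.1 i p = M.1 i p) ∧
      ∀ i, M'.1 p i = if i ∈ I then 0 else M.1 p i := by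
  induction I using Finset.induction_on with
  | empty => exact ⟨M, .refl _ _, hM, by simp⟩
  | insert a I ha ih =>
    obtain ⟨M', h1, h2, h4, h3⟩ := ih fun i hi => hI i (Finset.mem_insert_of_mem hi)
    obtain ⟨haT, hap⟩ := hI a (Finset.mem_insert_self _ _)
    refine ⟨_, ?_, h2.mul_transvection hp haT hap.symm (-M.1 p a), fun i => ?_, fun i => ?_⟩
    · rw [Finset.card_insert_of_notMem ha]
      exact h1.trans (transvectionRel_mul_right M' hap.symm _)
    · rw [mul_transvection_coe_apply, if_neg hap.symm, add_zero, h4]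
    · rw [mul_transvection_coe_apply, h4, hpp, h3]
      by_cases hia : i = a
      · subst hia; simp [ha]
      · simp [hia]

variable [Finite R]

/-- Column `p` is unimodular because `M⁻¹ * M = 1`, so by stable rank one row operations make the
pivot a unit. The spare index `q` turns the unit into 1 in two steps: first the entry at `(q, p)`,
then the pivot. Clearing column and row gives three passes over `I` plus 2. -/
lemma exists_transvectionRel_insert {T : Finset ι} {p q : ι} (hp : p ∉ T) (hq : q ∉ T)
    (hpq : p ≠ q) {M : SpecialLinearGroup ι R} (hM : IsReducedOn T M) :
    ∃ M', TransvectionRel (3 * Fintype.card ι + 2) M M' ∧ IsReducedOn (insert p T) M' := by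
  set I : Finset ι := (insert p T)ᶜ with hIdef
  have hI : ∀ i ∈ I, i ∉ T ∧ i ≠ p := by
    intro i hi
    rw [hIdef, Finset.mem_compl, Finset.mem_insert, not_or] at hi
    exact ⟨hi.2, hi.1⟩
  have hcard : I.card ≤ Fintype.card ι := Finset.card_le_univ I
  have hcop : IsCoprime (M.1 p p) (∑ i ∈ I, (M⁻¹).1 p i * M.1 i p) := by
    have h1 : ((M⁻¹ * M : SpecialLinearGroup ι R).1) p p = 1 := by simp
    rw [show ((M⁻¹ * M : SpecialLinearGroup ι R).1) = (M⁻¹).1 * M.1 from rfl, mul_apply] at h1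
    have h2 : ∑ i, (M⁻¹).1 p i * M.1 i p =
        ∑ i ∈ insert p I, (M⁻¹).1 p i * M.1 i p := by
      symm
      refine Finset.sum_subset (Finset.subset_univ _) fun i _ hi => ?_
      rw [hIdef, Finset.mem_insert, Finset.mem_compl, Finset.mem_insert, not_or, not_not] at hi
      have hiT : i ∈ T := hi.2.resolve_left hi.1
      rw [(hM i hiT p).2, one_apply_ne hi.1, mul_zero]
    rw [h2, Finset.sum_insert (fun h => (hI p h).2 rfl)] at h1
    exact ⟨(M⁻¹).1 p p, 1, by rw [one_mul]; exact h1⟩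
  obtain ⟨s, hs⟩ := exists_isUnit_add_mul_of_isCoprime hcop
  obtain ⟨M₁, r1, red1, hM1, -⟩ :=
    exists_transvectionRel_add_sum hp (fun i => s * (M⁻¹).1 p i) hM I hI
  have hu : IsUnit (M₁.1 p p) := by
    rw [hM1]
    simpa only [Finset.mul_sum, mul_assoc] using hs
  obtain ⟨w, hw⟩ := hu.exists_left_inv
  set M₂ := SpecialLinearGroup.transvection hpq.symm ((1 - M₁.1 q p) * w) * M₁ with hM2
  have r2 := transvectionRel_mul_left M₁ hpq.symm ((1 - M₁.1 q p) * w)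
  have red2 := red1.transvection_mul hq hp hpq.symm ((1 - M₁.1 q p) * w)
  have h2q : M₂.1 q p = 1 := by
    rw [hM2, transvection_mul_coe_apply, if_pos rfl, mul_assoc, hw]; ring
  set M₃ := SpecialLinearGroup.transvection hpq (1 - M₂.1 p p) * M₂ with hM3
  have r3 := transvectionRel_mul_left M₂ hpq (1 - M₂.1 p p)
  have red3 := red2.transvection_mul hp hq hpq (1 - M₂.1 p p)
  have h3p : M₃.1 p p = 1 := by
    rw [hM3, transvection_mul_coe_apply, if_pos rfl, h2q]; ring
  obtain ⟨M₄, r4, red4, h4⟩ := exists_transvectionRel_clear_column hp red3 h3p I hI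
  have hpI : p ∉ I := fun h => (hI p h).2 rfl
  have h4p : M₄.1 p p = 1 := by rw [h4, if_neg hpI, h3p]
  obtain ⟨M₅, r5, red5, h5c, h5r⟩ := exists_transvectionRel_clear_row hp red4 h4p I hI
  refine ⟨M₅, ((((r1.trans r2).trans r3).trans r4).trans r5).mono (by omega), ?_⟩
  intro j hj i
  rcases Finset.mem_insert.1 hj with rfl | hj
  · by_cases hi : i ∈ I
    · have hij := (hI i hi).2
      rw [h5c, h4, h5r, if_pos hi, if_pos hi, one_apply_ne hij, one_apply_ne hij.symm]
      exact ⟨rfl, rfl⟩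
    · rcases eq_or_ne i j with rfl | hij
      · rw [h5c, h4p, one_apply_eq]; exact ⟨rfl, rfl⟩
      · have hiT : i ∈ T := by
          rw [hIdef, Finset.mem_compl, not_not] at hi
          exact (Finset.mem_insert.1 hi).resolve_left hij
        exact ⟨(red5 i hiT j).2, (red5 i hiT j).1⟩
  · exact red5 j hj i

lemma exists_transvectionRel_isReducedOn (M : SpecialLinearGroup ι R) (q : ι) (T : Finset ι)
    (hq : q ∉ T) : ∃ M', TransvectionRel (T.card * (3 * Fintype.card ι + 2)) M M' ∧
      IsReducedOn T M' := by
  induction T using Finset.induction_on with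
  | empty => exact ⟨M, .refl _ _, by simp [IsReducedOn]⟩
  | insert p T hp ih =>
    rw [Finset.mem_insert, not_or] at hq
    obtain ⟨M₁, r1, red1⟩ := ih hq.2
    obtain ⟨M₂, r2, red2⟩ := exists_transvectionRel_insert hp hq.2 (Ne.symm hq.1) red1
    refine ⟨M₂, ?_, red2⟩
    rw [Finset.card_insert_of_notMem hp, add_mul, one_mul]
    exact r1.trans r2

/-- Bounded elementary generation of the special linear group over a finite commutative ring, with
a bound that depends only on the size of the matrices. -/
theorem isTransvectionProduct_of_finite [Nonempty ι] (M : SpecialLinearGroup ι R) :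
    IsTransvectionProduct (Fintype.card ι * (3 * Fintype.card ι + 2)) M := by
  obtain ⟨q⟩ := ‹Nonempty ι›
  obtain ⟨M', r, hM'⟩ := exists_transvectionRel_isReducedOn M q (Finset.univ.erase q) (by simp)
  have hoff : ∀ i j, ¬ (i = q ∧ j = q) → M'.1 i j = (1 : Matrix ι ι R) i j := by
    intro i j hij
    by_cases hi : i = q
    · exact (hM' j (by simpa using fun h => hij ⟨hi, h⟩) i).1
    · exact (hM' i (by simpa using hi) j).2
  have hdiag : M'.1 = diagonal fun i => M'.1 i i := by
    ext i j
    rcases eq_or_ne i j with rfl | hij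
    · simp
    · rw [diagonal_apply_ne _ hij, hoff i j (fun h => hij (h.1.trans h.2.symm)), one_apply_ne hij]
  -- The last diagonal entry is forced by the determinant.
  have hqq : M'.1 q q = 1 := by
    have h1 := M'.2
    rw [hdiag, det_diagonal, Finset.prod_eq_single q] at h1
    · exact h1
    · intro i _ hi
      rw [hoff i i (fun h => hi h.1), one_apply_eq]
    · simp
  have hone : M' = 1 := by
    ext i j
    by_cases h : i = q ∧ j = q
    · rw [h.1, h.2]; simpa using hqq
    · simpa using hoff i j h
  obtain ⟨a, b, g, h, hab, ⟨l, hl, hlp, hlt⟩, ⟨l', hl', hlp', hlt'⟩, hMeq⟩ := r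
  refine ⟨l ++ l', ?_, ?_, fun t ht => ?_⟩
  · have h1 : (Finset.univ.erase q).card ≤ Fintype.card ι := Finset.card_le_univ _
    have h2 := Nat.mul_le_mul_right (3 * Fintype.card ι + 2) h1
    rw [List.length_append]
    omega
  · rw [List.prod_append, hlp, hlp', hMeq, hone, mul_one]
  · rcases List.mem_append.1 ht with ht | ht
    exacts [hlt t ht, hlt' t ht]

end BoundedElementaryGeneration

/-! ### Uniform convexity of ℓ² sums -/

section UniformConvexity

/-- If `f - g` is not small relative to `f`, the parallelogram defect is at least `δ ^ 2 / 16 * ‖f‖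
^ 2`: by convexity when the norms are close, and from `(‖f‖ - ‖g‖) ^ 2` otherwise. -/
lemma sq_norm_sub_le_of_norm_le {F : Type*} [NormedAddCommGroup F] [NormedSpace ℝ F]
    {ε δ : ℝ} (hε : 0 < ε) (hδ : 0 < δ) (hδ1 : δ ≤ 1)
    (h : ∀ ⦃x : F⦄, ‖x‖ ≤ 1 → ∀ ⦃y⦄, ‖y‖ ≤ 1 → ε ≤ ‖x - y‖ → ‖x + y‖ ≤ 2 - δ)
    {f g : F} (hfg : ‖g‖ ≤ ‖f‖) :
    ‖f - g‖ ^ 2 ≤ ε ^ 2 * (‖f‖ ^ 2 + ‖g‖ ^ 2) +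
      64 / δ ^ 2 * (2 * (‖f‖ ^ 2 + ‖g‖ ^ 2) - ‖f + g‖ ^ 2) := by
  have hadd := norm_add_le f g
  have hsub := norm_sub_le f g
  have hg0 := norm_nonneg g
  have hsub2 : ‖f - g‖ ^ 2 ≤ 2 * (‖f‖ ^ 2 + ‖g‖ ^ 2) := by
    nlinarith [norm_nonneg (f - g), sq_nonneg (‖f‖ - ‖g‖)]
  have hadd2 : ‖f + g‖ ^ 2 ≤ 2 * (‖f‖ ^ 2 + ‖g‖ ^ 2) := by
    nlinarith [norm_nonneg (f + g), sq_nonneg (‖f‖ - ‖g‖)]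
  by_cases hd : ‖f - g‖ < ε * ‖f‖
  · have h1 : ‖f - g‖ ^ 2 ≤ ε ^ 2 * ‖f‖ ^ 2 := by
      rw [← mul_pow]; exact pow_le_pow_left₀ (norm_nonneg _) hd.le 2
    have h2 : 0 ≤ 64 / δ ^ 2 * (2 * (‖f‖ ^ 2 + ‖g‖ ^ 2) - ‖f + g‖ ^ 2) :=
      mul_nonneg (by positivity) (by linarith)
    nlinarith [sq_nonneg ε, sq_nonneg (ε * ‖g‖)]
  · push Not at hd
    rcases (norm_nonneg f).eq_or_lt with hf | hf
    · have hg : ‖g‖ = 0 := by linarith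
      have hs : ‖f - g‖ = 0 := le_antisymm (by linarith) (norm_nonneg _)
      have ha : ‖f + g‖ = 0 := le_antisymm (by linarith) (norm_nonneg _)
      rw [hs, ha, hg, ← hf]; simp
    have hscale : ‖f + g‖ ≤ (2 - δ) * ‖f‖ := by
      have h1 := @h (‖f‖⁻¹ • f) (by rw [norm_smul, norm_inv, norm_norm, inv_mul_cancel₀ hf.ne'])
        (‖f‖⁻¹ • g) (by
          rw [norm_smul, norm_inv, norm_norm, inv_mul_le_iff₀ hf, mul_one]; exact hfg) (by
          rw [← smul_sub, norm_smul, norm_inv, norm_norm, le_inv_mul_iff₀ hf]; linarith)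
      rwa [← smul_add, norm_smul, norm_inv, norm_norm, inv_mul_le_iff₀ hf, mul_comm] at h1
    have hgap : δ ^ 2 / 16 * ‖f‖ ^ 2 ≤ 2 * (‖f‖ ^ 2 + ‖g‖ ^ 2) - ‖f + g‖ ^ 2 := by
      by_cases hs : (1 - δ / 4) * ‖f‖ ≤ ‖g‖
      · have h1 : ‖f + g‖ ^ 2 ≤ ((2 - δ) * ‖f‖) ^ 2 :=
          pow_le_pow_left₀ (norm_nonneg _) hscale 2
        have h2 : ((1 - δ / 4) * ‖f‖) ^ 2 ≤ ‖g‖ ^ 2 :=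
          pow_le_pow_left₀ (mul_nonneg (by linarith) hf.le) hs 2
        have h3 : 0 ≤ (δ * (1 - δ)) * ‖f‖ ^ 2 :=
          mul_nonneg (mul_nonneg hδ.le (by linarith)) (sq_nonneg _)
        have h4 : 0 ≤ δ * ‖f‖ ^ 2 := by positivity
        nlinarith
      · push Not at hs
        have h1 : δ / 4 * ‖f‖ ≤ ‖f‖ - ‖g‖ := by linarith
        have h2 : (δ / 4 * ‖f‖) ^ 2 ≤ (‖f‖ - ‖g‖) ^ 2 :=
          pow_le_pow_left₀ (by positivity) h1 2
        have h3 : ‖f + g‖ ^ 2 ≤ (‖f‖ + ‖g‖) ^ 2 := pow_le_pow_left₀ (norm_nonneg _) hadd 2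
        nlinarith
    have h1 : 4 * ‖f‖ ^ 2 ≤ 64 / δ ^ 2 * (2 * (‖f‖ ^ 2 + ‖g‖ ^ 2) - ‖f + g‖ ^ 2) := by
      calc 4 * ‖f‖ ^ 2 = 64 / δ ^ 2 * (δ ^ 2 / 16 * ‖f‖ ^ 2) := by
            field_simp; ring
        _ ≤ _ := by gcongr
    have h2 : ‖g‖ ^ 2 ≤ ‖f‖ ^ 2 := pow_le_pow_left₀ hg0 hfg 2
    have h3 : 0 ≤ ε ^ 2 * (‖f‖ ^ 2 + ‖g‖ ^ 2) := by positivity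
    linarith

/-- Uniform convexity in a form linear in squared norms, so that it can be summed over coordinates
with the same constants. -/
lemma exists_sq_norm_sub_le (F : Type*) [NormedAddCommGroup F] [NormedSpace ℝ F]
    [UniformConvexSpace F] {ε : ℝ} (hε : 0 < ε) : ∃ K : ℝ, 0 < K ∧ ∀ f g : F,
    ‖f - g‖ ^ 2 ≤ ε ^ 2 * (‖f‖ ^ 2 + ‖g‖ ^ 2) +
      K * (2 * (‖f‖ ^ 2 + ‖g‖ ^ 2) - ‖f + g‖ ^ 2) := by
  obtain ⟨δ, hδ, h⟩ := exists_forall_closed_ball_dist_add_le_two_sub F hε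
  refine ⟨64 / (min δ 1) ^ 2, by positivity, fun f g => ?_⟩
  have h' : ∀ ⦃x : F⦄, ‖x‖ ≤ 1 → ∀ ⦃y⦄, ‖y‖ ≤ 1 → ε ≤ ‖x - y‖ → ‖x + y‖ ≤ 2 - min δ 1 :=
    fun x hx y hy hxy => (h hx hy hxy).trans (by linarith [min_le_left δ 1])
  rcases le_total ‖g‖ ‖f‖ with hfg | hfg
  · exact sq_norm_sub_le_of_norm_le hε (by positivity) (min_le_right _ _) h' hfg
  · have := sq_norm_sub_le_of_norm_le hε (by positivity) (min_le_right _ _) h' hfg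
    rwa [norm_sub_rev, add_comm (‖g‖ ^ 2), add_comm g f] at this

/-- The spaces `ℓ²(V; F)` are uniformly convex, uniformly in the finite set `V`. -/
theorem exists_isRound_piLp (F : Type u) [NormedAddCommGroup F] [NormedSpace ℝ F]
    [UniformConvexSpace F] : ∃ L : ℝ, 1 < L ∧ L ≤ 20 / 19 ∧
    ∀ (V : Type v) [Fintype V], IsRound (PiLp 2 fun _ : V => F) L := by
  obtain ⟨K, hK, h⟩ := exists_sq_norm_sub_le F (show (0 : ℝ) < 1 / 2 ^ 22 by positivity)
  -- The defect term becomes at most `2 ^ (-46) * μ ^ 2` and the other at most `2 ^ (-43) * μ ^ 2`,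
  -- together below `(μ / 2 ^ 20) ^ 2`. The `1 / 19` ensures `L ≤ 20 / 19`.
  set η : ℝ := min (1 / 19) (1 / (K * 2 ^ 50)) with hη
  have hη0 : 0 < η := by positivity
  have hηK : K * η ≤ 1 / 2 ^ 50 := by
    calc K * η ≤ K * (1 / (K * 2 ^ 50)) := by gcongr; exact min_le_right _ _
      _ = _ := by field_simp
  refine ⟨1 + η, by linarith, by linarith [min_le_left (1 / 19 : ℝ) (1 / (K * 2 ^ 50))], ?_⟩
  intro V _ w v μ hw hv hwv
  have hμ : 0 ≤ μ := (norm_nonneg w).trans hw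
  have hη1 : η ≤ 1 / 19 := min_le_left _ _
  have hsum : ‖w - v‖ ^ 2 ≤ (1 / 2 ^ 22) ^ 2 * (‖w‖ ^ 2 + ‖v‖ ^ 2) +
      K * (2 * (‖w‖ ^ 2 + ‖v‖ ^ 2) - ‖w + v‖ ^ 2) := by
    simp only [PiLp.norm_sq_eq_of_L2]
    rw [← Finset.sum_add_distrib, Finset.mul_sum, Finset.mul_sum, ← Finset.sum_sub_distrib,
      Finset.mul_sum, ← Finset.sum_add_distrib]
    exact Finset.sum_le_sum fun i _ => h (w i) (v i)
  have hw2 : ‖w‖ ^ 2 ≤ μ ^ 2 := pow_le_pow_left₀ (norm_nonneg _) hw 2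
  have hv2 : ‖v‖ ^ 2 ≤ μ ^ 2 := pow_le_pow_left₀ (norm_nonneg _) hv 2
  have hlow : 4 * μ ^ 2 * (1 - 4 * η) ≤ ‖w + v‖ ^ 2 := by
    have h1 : (2 * μ) ^ 2 ≤ ((1 + η) ^ 2 * ‖w + v‖) ^ 2 :=
      pow_le_pow_left₀ (by positivity) hwv.le 2
    have h2 : (1 - 4 * η) * (1 + η) ^ 4 ≤ 1 := by
      have h5 : 1 - 4 * η ≤ (1 - η) ^ 4 := by nlinarith [sq_nonneg η, sq_nonneg (η ^ 2)]
      have h6 : (1 - η) ^ 4 * (1 + η) ^ 4 ≤ 1 := by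
        rw [← mul_pow]
        exact pow_le_one₀ (mul_nonneg (by linarith) (by linarith)) (by nlinarith)
      exact (mul_le_mul_of_nonneg_right h5 (by positivity)).trans h6
    have h3 : 0 ≤ 1 - 4 * η := by linarith
    have h4 : 0 ≤ ‖w + v‖ ^ 2 := by positivity
    calc 4 * μ ^ 2 * (1 - 4 * η) = (2 * μ) ^ 2 * (1 - 4 * η) := by ring
      _ ≤ ((1 + η) ^ 2 * ‖w + v‖) ^ 2 * (1 - 4 * η) := by gcongr
      _ = ((1 - 4 * η) * (1 + η) ^ 4) * ‖w + v‖ ^ 2 := by ring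
      _ ≤ 1 * ‖w + v‖ ^ 2 := by gcongr
      _ = _ := one_mul _
  have hμ2 : 0 ≤ μ ^ 2 := sq_nonneg μ
  have hfin : ‖w - v‖ ^ 2 ≤ (μ / 2 ^ 20) ^ 2 := by
    have h1 : K * (2 * (‖w‖ ^ 2 + ‖v‖ ^ 2) - ‖w + v‖ ^ 2) ≤ K * (16 * η * μ ^ 2) := by
      gcongr; linarith
    have h2 : K * (16 * η * μ ^ 2) ≤ 16 * (1 / 2 ^ 50) * μ ^ 2 := by
      calc K * (16 * η * μ ^ 2) = 16 * (K * η) * μ ^ 2 := by ring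
        _ ≤ _ := by gcongr
    have h3 : (1 / 2 ^ 22 : ℝ) ^ 2 * (‖w‖ ^ 2 + ‖v‖ ^ 2) ≤ (1 / 2 ^ 22) ^ 2 * (2 * μ ^ 2) := by
      gcongr; linarith
    have h4 : (1 / 2 ^ 22 : ℝ) ^ 2 * (2 * μ ^ 2) + 16 * (1 / 2 ^ 50) * μ ^ 2 ≤
        (μ / 2 ^ 20) ^ 2 := by
      rw [div_pow]
      norm_num
      nlinarith
    linarith
  exact (pow_le_pow_iff_left₀ (norm_nonneg _) (by positivity) two_ne_zero).1 hfin

end UniformConvexity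

/-! ### Transvections as root elements -/

section Transvections

open Matrix

variable {ι R : Type*} [DecidableEq ι] [Fintype ι] [CommRing R]

lemma commute_transvection {a b c d : ι} (hab : a ≠ b) (hcd : c ≠ d) (hbc : b ≠ c) (had : a ≠ d)
    (r s : R) :
    Commute (SpecialLinearGroup.transvection hab r) (SpecialLinearGroup.transvection hcd s) :=
  Subtype.ext <| by
    simp [SpecialLinearGroup.transvection_coe, mul_add, add_mul, single_mul_single_of_ne, hbc,
      had.symm]
    abel

lemma transvection_mul_transvection {a b d : ι} (hab : a ≠ b) (hbd : b ≠ d) (had : a ≠ d)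
    {r s t : R} (h : r * s = t) :
    SpecialLinearGroup.transvection hab r * SpecialLinearGroup.transvection hbd s =
      SpecialLinearGroup.transvection had t * SpecialLinearGroup.transvection hbd s *
        SpecialLinearGroup.transvection hab r :=
  Subtype.ext <| by
    simp [SpecialLinearGroup.transvection_coe, mul_add, add_mul, single_mul_single_of_ne,
      had.symm, hbd.symm, h]
    abel

lemma transvection_mul_transvection' {a b d : ι} (hab : a ≠ b) (hbd : b ≠ d) (had : a ≠ d)
    {r s t : R} (h : r * s = -t) :
    SpecialLinearGroup.transvection hbd s * SpecialLinearGroup.transvection hab r =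
      SpecialLinearGroup.transvection had t * SpecialLinearGroup.transvection hab r *
        SpecialLinearGroup.transvection hbd s := by
  rw [mul_assoc, transvection_mul_transvection hab hbd had h, ← mul_assoc, ← mul_assoc,
    ← SpecialLinearGroup.transvection_add, add_neg_cancel,
    SpecialLinearGroup.transvection_coeff_zero, one_mul]

lemma transvection_one_pow {a b : ι} (hab : a ≠ b) (k : ℕ) :
    SpecialLinearGroup.transvection hab (1 : R) ^ k =
      SpecialLinearGroup.transvection hab (k : R) := by
  induction k with
  | zero => simp [SpecialLinearGroup.transvection_coeff_zero]
  | succ k ih => rw [pow_succ, ih, ← SpecialLinearGroup.transvection_add, Nat.cast_succ]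

lemma map_transvection {R' : Type*} [CommRing R'] (f : R →+* R') {a b : ι} (hab : a ≠ b) (r : R) :
    SpecialLinearGroup.map f (SpecialLinearGroup.transvection hab r) =
      SpecialLinearGroup.transvection hab (f r) := by
  ext i j
  simp [SpecialLinearGroup.transvection_coe, Matrix.one_apply, Matrix.single_apply, apply_ite f]

/-- The root elements of a copy of `SL₃`, in the cyclic order of the roots. -/
def transvectionHexagon {i j k : ι} (hij : i ≠ j) (hik : i ≠ k) (hjk : j ≠ k) :
    ZMod 6 → SpecialLinearGroup ι R :=
  ![SpecialLinearGroup.transvection hij 1, SpecialLinearGroup.transvection hik 1,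
    SpecialLinearGroup.transvection hjk 1, SpecialLinearGroup.transvection hij.symm (-1),
    SpecialLinearGroup.transvection hik.symm (-1), SpecialLinearGroup.transvection hjk.symm (-1)]

/-- Each root is the sum of its two neighbours. With the chosen signs the relation is always `x * y
= z * y * x`; `key` and `key'` treat the two orders in which the outer roots compose. -/
lemma isHexagon_transvectionHexagon {i j k : ι} (hij : i ≠ j) (hik : i ≠ k) (hjk : j ≠ k) :
    IsHexagon (transvectionHexagon (R := R) hij hik hjk) := by
  have key : ∀ {a b d : ι} (hab : a ≠ b) (hbd : b ≠ d) (had : a ≠ d) {r s t : R},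
      r * s = t → HeisenbergTriple (SpecialLinearGroup.transvection hab r)
        (SpecialLinearGroup.transvection had t) (SpecialLinearGroup.transvection hbd s) :=
    fun hab hbd had _ _ _ h =>
      ⟨commute_transvection _ _ had.symm hab _ _, commute_transvection _ _ hbd.symm had _ _,
        Or.inr (transvection_mul_transvection hab hbd had h)⟩
  have key' : ∀ {a b d : ι} (hab : a ≠ b) (hbd : b ≠ d) (had : a ≠ d) {r s t : R},
      r * s = -t → HeisenbergTriple (SpecialLinearGroup.transvection hbd s)
        (SpecialLinearGroup.transvection had t) (SpecialLinearGroup.transvection hab r) :=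
    fun hab hbd had _ _ _ h =>
      ⟨commute_transvection _ _ hbd.symm had _ _, commute_transvection _ _ had.symm hab _ _,
        Or.inr (transvection_mul_transvection' hab hbd had h)⟩
  intro m
  fin_cases m
  · exact key hij hjk hik (by ring)
  · exact key' hij.symm hik hjk (by ring)
  · exact key hjk hik.symm hij.symm (by ring)
  · exact key' hjk.symm hij.symm hik.symm (by ring)
  · exact key hik.symm hij hjk.symm (by ring)
  · exact key' hik hjk.symm hij (by ring)

end Transvections

/-! ### Displacement of vectors under isometric representations -/

section Displacement

variable {E : Type*} [NormedAddCommGroup E] [NormedSpace ℝ E] {G : Type*} [Group G]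
  {ρ : G →* (E →L[ℝ] E)}

lemma norm_map_mul_sub_le (hρ : ∀ g, ‖ρ g‖ ≤ 1) (g h : G) (ξ : E) :
    ‖ρ (g * h) ξ - ξ‖ ≤ ‖ρ g ξ - ξ‖ + ‖ρ h ξ - ξ‖ := by
  have h1 : ρ (g * h) ξ - ξ = ρ g (ρ h ξ - ξ) + (ρ g ξ - ξ) := by
    rw [map_mul, mul_apply_eq_comp, map_sub]; abel
  rw [h1, add_comm ‖ρ g ξ - ξ‖]
  exact (norm_add_le _ _).trans (add_le_add_left (norm_apply_le_of_norm_le_one (hρ g) _) _)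

lemma norm_map_inv_sub_le (hρ : ∀ g, ‖ρ g‖ ≤ 1) (g : G) (ξ : E) :
    ‖ρ g⁻¹ ξ - ξ‖ ≤ ‖ρ g ξ - ξ‖ := by
  have h1 : ρ g⁻¹ ξ - ξ = ρ g⁻¹ (ξ - ρ g ξ) := by
    rw [map_sub, ← mul_apply_eq_comp, ← map_mul, inv_mul_cancel, map_one, one_apply_eq_self]
  rw [h1, norm_sub_rev (ρ g ξ)]
  exact norm_apply_le_of_norm_le_one (hρ _) _

lemma norm_map_list_prod_sub_le (hρ : ∀ g, ‖ρ g‖ ≤ 1) {ξ : E} {B : ℝ} (l : List G)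
    (hl : ∀ t ∈ l, ‖ρ t ξ - ξ‖ ≤ B) : ‖ρ l.prod ξ - ξ‖ ≤ l.length * B := by
  induction l with
  | nil => simp
  | cons t l ih =>
    rw [List.prod_cons, List.length_cons]
    have h1 := ih fun s hs => hl s (List.mem_cons_of_mem _ hs)
    have h2 := hl t List.mem_cons_self
    push_cast
    linarith [norm_map_mul_sub_le hρ t l.prod ξ]

/-- Here `ℓ` is a word length, chosen before the representation; this gives uniformity over all
moduli. -/
lemma exists_norm_map_sub_le_of_mem_closure {S : Set G} {g : G} (hg : g ∈ Subgroup.closure S) :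
    ∃ ℓ : ℕ, ∀ (E : Type u) [NormedAddCommGroup E] [NormedSpace ℝ E] (ρ : G →* (E →L[ℝ] E))
      (ξ : E) (D : ℝ), (∀ g, ‖ρ g‖ ≤ 1) → (∀ s ∈ S, ‖ρ s ξ - ξ‖ ≤ D) →
        ‖ρ g ξ - ξ‖ ≤ ℓ * D := by
  induction hg using Subgroup.closure_induction with
  | mem s hs => exact ⟨1, fun E _ _ ρ ξ D _ h => by simpa using h s hs⟩
  | one => exact ⟨0, fun E _ _ ρ ξ D _ _ => by simp⟩
  | mul a b _ _ iha ihb =>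
    obtain ⟨ℓ, h⟩ := iha
    obtain ⟨ℓ', h'⟩ := ihb
    refine ⟨ℓ + ℓ', fun E _ _ ρ ξ D hρ hD => ?_⟩
    push_cast
    linarith [norm_map_mul_sub_le hρ a b ξ, h E ρ ξ D hρ hD, h' E ρ ξ D hρ hD]
  | inv a _ iha =>
    obtain ⟨ℓ, h⟩ := iha
    exact ⟨ℓ, fun E _ _ ρ ξ D hρ hD => (norm_map_inv_sub_le hρ a ξ).trans (h E ρ ξ D hρ hD)⟩

/-- An affine bound on all displacements, with slope at most `1 / 2`, improves to a linear one:
subtract the mean of the orbit. -/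
lemma norm_map_sub_le_of_half [Fintype G] (hρ : ∀ g, ‖ρ g‖ ≤ 1) {T : Set G} {D C : ℝ}
    (hT : ∀ ξ : E, (∀ t ∈ T, ‖ρ t ξ - ξ‖ ≤ D) → ∀ g, ‖ρ g ξ - ξ‖ ≤ C + 1 / 2 * ‖ξ‖)
    {ξ : E} (hξ : ∀ t ∈ T, ‖ρ t ξ - ξ‖ ≤ D) (g : G) : ‖ρ g ξ - ξ‖ ≤ 4 * C := by
  set N : ℝ := (Fintype.card G : ℝ) with hN
  have hN0 : 0 < N := Nat.cast_pos.2 Fintype.card_pos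
  set η : E := N⁻¹ • ∑ h, ρ h ξ with hη
  have hinv : ∀ h, ρ h η = η := by
    intro h
    rw [hη, map_smul, map_sum]
    congr 1
    refine Fintype.sum_equiv (Equiv.mulLeft h) _ _ fun k => ?_
    rw [Equiv.coe_mulLeft, map_mul, mul_apply_eq_comp]
  have hdisp : ∀ h, ρ h (ξ - η) - (ξ - η) = ρ h ξ - ξ := by
    intro h
    rw [map_sub, hinv]; abel
  have hB : ∀ h, ‖ρ h (ξ - η) - (ξ - η)‖ ≤ C + 1 / 2 * ‖ξ - η‖ :=
    hT _ fun t ht => by rw [hdisp]; exact hξ t ht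
  -- The orbit of `ξ - η` has mean zero, so up to sign this vector is the mean of its own
  -- displacements; hence `‖ξ - η‖ ≤ 2 * C`.
  have hsum : ∑ h, (ρ h (ξ - η) - (ξ - η)) = -(N • (ξ - η)) := by
    simp only [hdisp]
    rw [Finset.sum_sub_distrib, Finset.sum_const, Finset.card_univ, ← Nat.cast_smul_eq_nsmul ℝ,
      smul_sub, hη, smul_smul, mul_inv_cancel₀ hN0.ne', one_smul, neg_sub]
  have h1 : N * ‖ξ - η‖ ≤ N * (C + 1 / 2 * ‖ξ - η‖) := by
    calc N * ‖ξ - η‖ = ‖∑ h, (ρ h (ξ - η) - (ξ - η))‖ := by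
          rw [hsum, norm_neg, norm_smul, Real.norm_of_nonneg hN0.le]
      _ ≤ ∑ h : G, (C + 1 / 2 * ‖ξ - η‖) := norm_sum_le_of_le _ fun h _ => hB h
      _ = N * (C + 1 / 2 * ‖ξ - η‖) := by
          rw [Finset.sum_const, Finset.card_univ, nsmul_eq_mul]
  have h2 := le_of_mul_le_mul_left h1 hN0
  have h3 := norm_sub_le (ρ g (ξ - η)) (ξ - η)
  rw [hdisp] at h3
  linarith [norm_apply_le_of_norm_le_one (hρ g) (ξ - η)]

end Displacement

/-! ### Uniform spectral gap -/

section SpectralGap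

open Matrix

/-- All finite quotients `SL_n(ℤ/mℤ)` have a uniform spectral gap in round spaces. -/
theorem exists_forall_norm_map_sub_le {n : ℕ} (hn : 3 ≤ n) {S : Set (SpecialLinearGroup (Fin n) ℤ)}
    (hgen : Subgroup.closure S = ⊤) {L : ℝ} (hL0 : 1 < L) (hL : L ≤ 20 / 19) :
    ∃ K : ℝ, 0 ≤ K ∧ ∀ (m : ℕ) [NeZero m] (E : Type u) [NormedAddCommGroup E] [NormedSpace ℝ E]
      (ρ : SpecialLinearGroup (Fin n) (ZMod m) →* (E →L[ℝ] E)) (ξ : E) (D : ℝ), IsRound E L →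
      (∀ g, ‖ρ g‖ ≤ 1) → 0 ≤ D → (∀ s ∈ reducedGenerators n m S, ‖ρ s ξ - ξ‖ ≤ D) →
      ∀ g, ‖ρ g ξ - ξ‖ ≤ K * D := by
  have : Nonempty (Fin n) := ⟨⟨0, by omega⟩⟩
  set N : ℕ := Fintype.card (Fin n) * (3 * Fintype.card (Fin n) + 2) with hN
  have hN0 : (0 : ℝ) < N := by
    have : 0 < N := by rw [hN, Fintype.card_fin]; positivity
    exact_mod_cast this
  -- With this `ε`, a product of `N` transvections picks up at most `1 / 2 * ‖ξ‖`, the slope allowed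
  -- in `norm_map_sub_le_of_half`.
  obtain ⟨C, hC0, hC⟩ :=
    exists_forall_norm_hexagon_pow_sub_le.{u, 0} hL0 hL (ε := 1 / (2 * N)) (by positivity)
  choose w hw using fun g : SpecialLinearGroup (Fin n) ℤ =>
    exists_norm_map_sub_le_of_mem_closure.{u} (S := S) (g := g) (by rw [hgen]; trivial)
  let τ : {q : Fin n × Fin n // q.1 ≠ q.2} × ℤˣ → SpecialLinearGroup (Fin n) ℤ :=
    fun q => SpecialLinearGroup.transvection q.1.2 (q.2 : ℤ)
  set W : ℕ := Finset.univ.sup fun q => w (τ q) with hW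
  refine ⟨4 * (N * (C * W)), by positivity, fun m _ E _ _ ρ ξ D hround hρ hD0 hD => ?_⟩
  have hdisp : ∀ ξ : E, (∀ s ∈ reducedGenerators n m S, ‖ρ s ξ - ξ‖ ≤ D) →
      ∀ (a b : Fin n) (hab : a ≠ b) (c : ℤˣ),
      ‖ρ (SpecialLinearGroup.transvection hab ((c : ℤ) : ZMod m)) ξ - ξ‖ ≤ W * D := by
    intro ξ hξ a b hab c
    have h1 := hw (τ ⟨⟨(a, b), hab⟩, c⟩) E
      (ρ.comp (SpecialLinearGroup.map (Int.castRingHom (ZMod m)))) ξ D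
      (fun g => hρ _) (fun s hs => hξ _ ⟨s, hs, rfl⟩)
    rw [MonoidHom.comp_apply, map_transvection] at h1
    refine h1.trans (mul_le_mul_of_nonneg_right ?_ hD0)
    exact_mod_cast Finset.le_sup (f := fun q => w (τ q)) (Finset.mem_univ _)
  have htrans : ∀ ξ : E, (∀ s ∈ reducedGenerators n m S, ‖ρ s ξ - ξ‖ ≤ D) →
      ∀ (i j : Fin n) (hij : i ≠ j) (c : ZMod m),
      ‖ρ (SpecialLinearGroup.transvection hij c) ξ - ξ‖ ≤
        C * (W * D) + 1 / (2 * N) * ‖ξ‖ := by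
    intro ξ hξ i j hij c
    -- A third index, available since `n ≥ 3`, places the transvection in a copy of SL₃. A general
    -- entry `c` is reached as the power `c.val`, and the bound is uniform in the exponent.
    obtain ⟨k, hk⟩ : ∃ k, k ∉ ({i, j} : Finset (Fin n)) := by
      by_contra! h
      have h1 := Finset.card_le_card (fun k _ => h k : Finset.univ ⊆ ({i, j} : Finset (Fin n)))
      rw [Finset.card_univ, Fintype.card_fin] at h1
      have h2 := Finset.card_le_two (a := i) (b := j)
      omega
    rw [Finset.mem_insert, Finset.mem_singleton, not_or] at hk
    have h1 := hC E _ ρ _ ξ (W * D) hround hρ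
      (isHexagon_transvectionHexagon hij (Ne.symm hk.1) (Ne.symm hk.2)) ?_ c.val
    · rwa [show transvectionHexagon hij (Ne.symm hk.1) (Ne.symm hk.2) (0 : ZMod 6) =
        SpecialLinearGroup.transvection hij (1 : ZMod m) from rfl, transvection_one_pow,
        ZMod.natCast_zmod_val] at h1
    · have hp : ∀ (a b : Fin n) (hab : a ≠ b),
          ‖ρ (SpecialLinearGroup.transvection hab (1 : ZMod m)) ξ - ξ‖ ≤ W * D := fun a b hab => by
        simpa using hdisp ξ hξ a b hab 1
      have hm : ∀ (a b : Fin n) (hab : a ≠ b),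
          ‖ρ (SpecialLinearGroup.transvection hab (-1 : ZMod m)) ξ - ξ‖ ≤ W * D :=
        fun a b hab => by simpa using hdisp ξ hξ a b hab (-1)
      intro q
      fin_cases q
      exacts [hp i j hij, hp i k (Ne.symm hk.1), hp j k (Ne.symm hk.2), hm j i hij.symm,
        hm k i hk.1, hm k j hk.2]
  intro g
  refine le_of_le_of_eq (b := 4 * (N * (C * W) * D))
    (norm_map_sub_le_of_half hρ (fun ξ hξ g => ?_) hD g) (by ring)
  obtain ⟨l, hl, rfl, hlt⟩ := isTransvectionProduct_of_finite g
  have hB : 0 ≤ C * (W * D) + 1 / (2 * N) * ‖ξ‖ := by positivity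
  refine (norm_map_list_prod_sub_le hρ l fun t ht => ?_).trans
    ((mul_le_mul_of_nonneg_right (Nat.cast_le.2 hl) hB).trans_eq ?_)
  · obtain ⟨i, j, hij, c, rfl⟩ := hlt t ht
    exact htrans ξ hξ i j hij c
  · rw [← hN]
    field_simp

end SpectralGap

/-! ### The right regular representation and Cayley graph sums -/

section RegularRepresentation

variable (F : Type*) [NormedAddCommGroup F] [NormedSpace ℝ F] (G : Type*) [Group G] [Fintype G]

/-- The right regular representation of a finite group `G` on `ℓ²(G, F)`. -/
noncomputable def rightRegular : G →* ((PiLp 2 fun _ : G => F) →L[ℝ] PiLp 2 fun _ : G => F) where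
  toFun g := (LinearIsometryEquiv.piLpCongrLeft 2 ℝ F
    (Equiv.mulRight g⁻¹)).toContinuousLinearEquiv.toContinuousLinearMap
  map_one' := by
    ext ξ u
    change ξ (u * 1⁻¹⁻¹) = ξ u
    rw [inv_inv, mul_one]
  map_mul' g h := by
    ext ξ u
    change ξ (u * (g * h)⁻¹⁻¹) = ξ (u * g⁻¹⁻¹ * h⁻¹⁻¹)
    simp only [inv_inv, mul_assoc]

variable {F G}

lemma rightRegular_apply (g : G) (ξ : PiLp 2 fun _ : G => F) (u : G) :
    rightRegular F G g ξ u = ξ (u * g) := by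
  simp [rightRegular, LinearIsometryEquiv.piLpCongrLeft_apply, Equiv.piCongrLeft']

lemma norm_rightRegular_le (g : G) : ‖rightRegular F G g‖ ≤ 1 :=
  ContinuousLinearMap.opNorm_le_bound _ zero_le_one fun ξ => by
    rw [one_mul]
    exact (LinearIsometryEquiv.norm_map (LinearIsometryEquiv.piLpCongrLeft 2 ℝ F
      (Equiv.mulRight g⁻¹)) ξ).le

lemma norm_rightRegular_sub_sq (g : G) (φ : G → F) :
    ‖rightRegular F G g (WithLp.toLp 2 φ) - WithLp.toLp 2 φ‖ ^ 2 =
      ∑ u, ‖φ (u * g) - φ u‖ ^ 2 := by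
  rw [PiLp.norm_sq_eq_of_L2]
  simp [rightRegular_apply]

lemma sum_norm_sub_sq_eq (φ : G → F) :
    ∑ e : G × G, ‖φ e.1 - φ e.2‖ ^ 2 =
      ∑ g, ‖rightRegular F G g (WithLp.toLp 2 φ) - WithLp.toLp 2 φ‖ ^ 2 := by
  simp only [norm_rightRegular_sub_sq]
  rw [Fintype.sum_prod_type_right, Finset.sum_comm (s := (Finset.univ : Finset G)) (f := fun g u => ‖φ (u * g) - φ u‖ ^ 2)]
  refine Finset.sum_congr rfl fun u _ => ?_
  exact (Fintype.sum_equiv (Equiv.mulLeft u) _ _ fun g => rfl).symm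

open Classical in
lemma norm_rightRegular_sub_sq_le {S : Set G} {s : G} (hs : s ∈ S) (φ : G → F) :
    ‖rightRegular F G s (WithLp.toLp 2 φ) - WithLp.toLp 2 φ‖ ^ 2 ≤
      ∑ e : G × G with (SimpleGraph.mulCayley S).Adj e.1 e.2, ‖φ e.1 - φ e.2‖ ^ 2 := by
  rw [norm_rightRegular_sub_sq, Finset.sum_filter, Fintype.sum_prod_type_right]
  refine Finset.sum_le_sum fun u _ => ?_
  by_cases h : u * s = u
  · rw [h, sub_self, norm_zero, zero_pow two_ne_zero]
    exact Finset.sum_nonneg fun v _ => by split_ifs <;> positivity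
  · refine le_trans (le_of_eq ?_) (Finset.single_le_sum (fun v _ => ?_) (Finset.mem_univ (u * s)))
    · rw [if_pos]
      exact (SimpleGraph.mulCayley_adj' S _ _).2 ⟨h, s, hs, Or.inr rfl⟩
    · split_ifs <;> positivity

end RegularRepresentation

/-! ### Degrees, cardinalities and the Poincaré inequality -/

lemma ncard_neighborSet_mulCayley_le {G : Type*} [Group G] {S : Set G} (hS : S.Finite) (x : G) :
    ((SimpleGraph.mulCayley S).neighborSet x).ncard ≤ 2 * S.ncard := by
  have h1 : (SimpleGraph.mulCayley S).neighborSet x ⊆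
      (fun s => x * s) '' S ∪ (fun s => x * s⁻¹) '' S := by
    intro y hy
    obtain ⟨-, s, hs, h | h⟩ := (SimpleGraph.mulCayley_adj' S _ _).1 hy
    · exact Or.inl ⟨s, hs, h⟩
    · exact Or.inr ⟨s, hs, by rw [h]; group⟩
  calc _ ≤ _ := Set.ncard_le_ncard h1 ((hS.image _).union (hS.image _))
    _ ≤ _ := Set.ncard_union_le _ _
    _ ≤ S.ncard + S.ncard := add_le_add (Set.ncard_image_le hS) (Set.ncard_image_le hS)
    _ = _ := (two_mul _).symm

lemma le_card_specialLinearGroup {n : ℕ} (hn : 2 ≤ n) (m : ℕ) [NeZero m] :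
    m ≤ Fintype.card (Matrix.SpecialLinearGroup (Fin n) (ZMod m)) := by
  have h01 : (⟨0, by omega⟩ : Fin n) ≠ ⟨1, by omega⟩ := by simp
  refine (ZMod.card m).symm.le.trans (Fintype.card_le_of_injective (Matrix.SpecialLinearGroup.transvection h01) fun a b h => ?_)
  have := congr_arg (fun M : Matrix.SpecialLinearGroup (Fin n) (ZMod m) =>
    M ⟨0, by omega⟩ ⟨1, by omega⟩) h
  simpa [Matrix.SpecialLinearGroup.transvection_coe] using this

/-- The left side is the sum over all `g` of the squared displacement of `φ` in ℓ². Each generator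
moves `φ` by at most the square root of the edge sum, so the spectral gap bounds every term. -/
theorem hasPoincareInequality_of_uniformConvexSpace {n : ℕ} (hn : 3 ≤ n)
    {S : Set (Matrix.SpecialLinearGroup (Fin n) ℤ)} (hgen : Subgroup.closure S = ⊤)
    (F : Type u) [NormedAddCommGroup F] [NormedSpace ℝ F] [UniformConvexSpace F] :
    ∃ γ : ℝ, 0 ≤ γ ∧ ∀ (m : ℕ) [NeZero m]
      (φ : Matrix.SpecialLinearGroup (Fin n) (ZMod m) → F),
      ∑ e : Matrix.SpecialLinearGroup (Fin n) (ZMod m) × Matrix.SpecialLinearGroup (Fin n) (ZMod m),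
        ‖φ e.1 - φ e.2‖ ^ 2 ≤
      γ * Fintype.card (Matrix.SpecialLinearGroup (Fin n) (ZMod m)) *
        open Classical in
        ∑ e : Matrix.SpecialLinearGroup (Fin n) (ZMod m) ×
            Matrix.SpecialLinearGroup (Fin n) (ZMod m) with
          (SimpleGraph.mulCayley (reducedGenerators n m S)).Adj e.1 e.2, ‖φ e.1 - φ e.2‖ ^ 2 := by
  classical
  obtain ⟨L, hL0, hL, hround⟩ := exists_isRound_piLp.{u, 0} F
  obtain ⟨K, hK0, hK⟩ := exists_forall_norm_map_sub_le.{u} hn hgen hL0 hL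
  refine ⟨K ^ 2, by positivity, fun m _ φ => ?_⟩
  set A := ∑ e : Matrix.SpecialLinearGroup (Fin n) (ZMod m) ×
            Matrix.SpecialLinearGroup (Fin n) (ZMod m) with
          (SimpleGraph.mulCayley (reducedGenerators n m S)).Adj e.1 e.2, ‖φ e.1 - φ e.2‖ ^ 2
    with hA
  have hA0 : 0 ≤ A := Finset.sum_nonneg fun e _ => by positivity
  have h1 := hK m (PiLp 2 fun _ : Matrix.SpecialLinearGroup (Fin n) (ZMod m) => F)
    (rightRegular F _) (WithLp.toLp 2 φ) (√A) (hround _) norm_rightRegular_le (Real.sqrt_nonneg A)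
    fun s hs => Real.le_sqrt_of_sq_le (by convert norm_rightRegular_sub_sq_le hs φ)
  rw [sum_norm_sub_sq_eq]
  calc _ ≤ ∑ g : Matrix.SpecialLinearGroup (Fin n) (ZMod m), K ^ 2 * A :=
        Finset.sum_le_sum fun g _ => by
          rw [← Real.sq_sqrt hA0, ← mul_pow]
          exact pow_le_pow_left₀ (norm_nonneg _) (h1 g) 2
    _ = _ := by rw [Finset.sum_const, Finset.card_univ, nsmul_eq_mul]; ring

/-- The sequence is indexed by `i : ℕ`, the `i`-th graph being the Cayley graph modulo `i + 1`. -/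
theorem theorem1p6 (n : ℕ) (hn : 3 ≤ n) (S : Set (Matrix.SpecialLinearGroup (Fin n) ℤ))
    (hfin : S.Finite) (hgen : Subgroup.closure S = ⊤) :
    IsSuperExpanderFamily.{u}
      (fun i : ℕ => Matrix.SpecialLinearGroup (Fin n) (ZMod (i + 1)))
      (fun i : ℕ => SimpleGraph.mulCayley (reducedGenerators n (i + 1) S)) := by
  refine ⟨⟨2 * S.ncard, fun i x => ?_⟩, ?_, ?_⟩
  · exact (ncard_neighborSet_mulCayley_le (hfin.image _) x).trans
      (Nat.mul_le_mul_left 2 (Set.ncard_image_le hfin))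
  · exact tendsto_atTop_mono (fun i => (Nat.le_succ i).trans
      (le_card_specialLinearGroup (by omega) (i + 1))) tendsto_id
  · rintro E _ _ _ ⟨F, _, _, _, ⟨e⟩⟩
    obtain ⟨γ, hγ0, hγ⟩ := hasPoincareInequality_of_uniformConvexSpace hn hgen F
    set a := ‖(e : E →L[ℝ] F)‖
    set b := ‖(e.symm : F →L[ℝ] E)‖
    -- The `+ 1` keeps the constant positive even if `γ`, `a` or `b` vanishes.
    refine ⟨2, b ^ 2 * γ * a ^ 2 + 1, by norm_num, by positivity, fun i φ => ?_⟩
    have hab : ∀ x y, ‖e x - e y‖ ^ 2 ≤ a ^ 2 * ‖x - y‖ ^ 2 := fun x y => by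
      rw [← mul_pow, ← map_sub]
      exact pow_le_pow_left₀ (norm_nonneg _) ((e : E →L[ℝ] F).le_opNorm _) 2
    have hba : ∀ x y, ‖x - y‖ ^ 2 ≤ b ^ 2 * ‖e x - e y‖ ^ 2 := fun x y => by
      rw [← mul_pow, ← map_sub]
      refine pow_le_pow_left₀ (norm_nonneg _) ?_ 2
      simpa using (e.symm : F →L[ℝ] E).le_opNorm (e (x - y))
    simp only [Real.rpow_ofNat]
    have h1 := hγ (i + 1) fun u => e (φ u)
    set V := Matrix.SpecialLinearGroup (Fin n) (ZMod (i + 1))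
    set N : ℝ := (Fintype.card V : ℝ) with hN
    have hN0 : 0 < N := Nat.cast_pos.2 Fintype.card_pos
    have h2 : ∑ e : V × V, ‖φ e.1 - φ e.2‖ ^ 2 ≤
        b ^ 2 * ∑ p : V × V, ‖e (φ p.1) - e (φ p.2)‖ ^ 2 := by
      rw [Finset.mul_sum]
      exact Finset.sum_le_sum fun p _ => hba _ _
    classical
    set A := ∑ p : V × V with (SimpleGraph.mulCayley (reducedGenerators n (i + 1) S)).Adj p.1 p.2,
      ‖φ p.1 - φ p.2‖ ^ 2 with hA
    have hA0 : 0 ≤ A := Finset.sum_nonneg fun e _ => by positivity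
    have h3 : ∑ p : V × V with (SimpleGraph.mulCayley (reducedGenerators n (i + 1) S)).Adj p.1 p.2,
      ‖e (φ p.1) - e (φ p.2)‖ ^ 2 ≤ a ^ 2 * A := by
      rw [hA, Finset.mul_sum]
      exact Finset.sum_le_sum fun p _ => hab _ _
    have h4 : ∑ e : V × V, ‖φ e.1 - φ e.2‖ ^ 2 ≤ N * ((b ^ 2 * γ * a ^ 2 + 1) * A) := by
      calc _ ≤ _ := h2
        _ ≤ b ^ 2 * (γ * N * (a ^ 2 * A)) := by
          gcongr
          refine h1.trans ?_
          gcongr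
        _ = N * (b ^ 2 * γ * a ^ 2 * A) := by ring
        _ ≤ _ := by gcongr; linarith
    calc _ ≤ 1 / N ^ 2 * (N * ((b ^ 2 * γ * a ^ 2 + 1) * A)) := by gcongr
      _ = (b ^ 2 * γ * a ^ 2 + 1) / N * A := by field_simp
      _ ≤ _ := by
        refine le_of_eq ?_
        rw [hA]
        congr!
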